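/- Let $\mathbb K=\mathbb R$ or $\mathbb C$, let $V$ be an $N$-dimensional $\mathbb K$-vector space with basis $x_1,\dots,x_N$, and let $q\in\mathbb K$, $q\neq 0$, with $q^n\ne 1$ for all $n\ge 1$. Put $k_q=\frac{q^k-q^{-k}}{q-q^{-1}}$. Let $R:V^{\otimes 2}\to V^{\otimes 2}$, $R(x_i\otimes x_j)=\sum_{k,l} R_{ij}^{kl}\,x_k\otimes x_l$, be a skew-invertible Hecke symmetry, that is: $R_{12}R_{23}R_{12}=R_{23}R_{12}R_{23}$ on $V^{\otimes 3}$; $(qI-R)(q^{-1}I+R)=0$; and there is $\Psi:V^{\otimes 2}\to V^{\otimes 2}$ with $\sum_{j,l}R_{ij}^{kl}\Psi_{lp}^{jr}=\delta_i^r\delta_p^k$. Write $R_k=R_{k\,k+1}$, $C_i^j=\sum_k\Psi_{ik}^{jk}$, $\mathrm{Tr}_R M=\mathrm{Tr}(CM)$, and let $\mathrm{Tr}_{R(i_1\dots i_k)}$ be the $R$-trace in the copies $i_1,\dots,i_k$ of $V$. Define the skew-symmetrizers on $V^{\otimes k}$ by $\mathcal P_-^{(1)}=I$ and $\mathcal P_-^{(k)}=\frac1{k_q}\mathcal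 P_-^{(k-1)}\bigl(q^{k-1}I-(k-1)_qR_{k-1}\bigr)\mathcal P_-^{(k-1)}$, where $\mathcal P_-^{(k-1)}$ acts in the copies $1,\dots,k-1$. Let $\mathbf Y(R)$ be the braided Yangian: the unital associative $\mathbb K$-algebra generated by the entries of the matrices $L[k]=\|l_i^j[k]\|_{1\le i,j\le N}$, $k\ge 1$, subject to the relations $$R(u,v)\,L_1(u)\,R\,L_1(v)=L_1(v)\,R\,L_1(u)\,R(u,v),\qquad R(u,v)=R-\frac{(q-q^{-1})u}{u-v}\,I,$$ where $L(u)=I+\sum_{k\ge1}L[k]u^{-k}$ is the generating matrix and $L_1(u)=L(u)\otimes I$ (the relations are multiplied by $u-v$ and compared coefficientwise). Put $L_{\overline 1}(u)=L_1(u)$, $L_{\overline k}(u)=R_{k-1}L_{\overline{k-1}}(u)R_{k-1}^{-1}$ for $k\ge 2$, and $$L^0(u)=I,\qquad L^k(u)=L(q^{-2(k-1)}u)\,L(q^{-2(k-2)}u)\cdots L(u),\qquad p_k(u)=\mathrm{Tr}_R L^k(u)\qquad (k\ge1),$$ $$L^{\wedge 1}(u)=L(u),\qquad L^{\wedge k}(u)=\mathrm{Tr}_{R(2\dots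 k)}\bigl(\mathcal P_-^{(k)}L_{\overline 1}(u)L_{\overline 2}(q^{-2}u)\cdots L_{\overline k}(q^{-2(k-1)}u)\bigr)\qquad (k\ge 2),$$ $$e_0(u)=1,\qquad e_k(u)=\mathrm{Tr}_RL^{\wedge k}(u)\qquad (k\ge 1).$$ Then the following identities hold. (i) (Cayley–Hamilton–Newton identities) For all $k\ge1$, $$(-1)^{k+1}k_q\,L^{\wedge k}(u)=\sum_{p=1}^k(-q)^{k-p}\,L^p(q^{-2(k-p)}u)\,e_{k-p}(u).$$ (ii) (Cayley–Hamilton identity) If the bi-rank of $R$ is $(m|0)$, then $$\sum_{p=0}^m(-q)^p\,L^{m-p}(q^{-2p}u)\,e_p(u)=0.$$ Here the bi-rank of $R$ is $(m|n)$ if the Poincaré–Hilbert series $\sum_k\dim\bigwedge_R^{(k)}(V)\,t^k$ of the algebra $\bigwedge_R(V)=T(V)/\langle\mathrm{Im}(q^{-1}I+R)\rangle$ is a quotient of two coprime polynomials, the numerator of degree $m$ and the denominator of degree $n$. (iii) (quantum Newton identities) For all $k\ge 1$, $$\sum_{p=0}^{k-1}(-q)^p\,p_{k-p}(q^{-2p}u)\,e_p(u)+(-1)^k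 k_q\,e_k(u)=0.$$ -/

import Mathlib

open scoped PowerSeries

namespace BraidedYangian

/-!
Conventions.  `V` has the basis `x_i`, `i : Fin N`.  An operator on `V` with `M (x_i) = M_i^j x_j` is
the matrix `M i j = M_i^j` (row = lower index, column = upper index), and an operator on `V ⊗ V` with
`R (x_i ⊗ x_j) = R_{ij}^{kl} x_k ⊗ x_l` is the matrix `R (i, j) (k, l) = R_{ij}^{kl}`.  A matrix
indexed by `Fin n → Fin N` acts in `n` copies of `V`, the copies being numbered `0, …, n - 1`.
Products are products of matrices, `(A B)_i^j = A_i^k B_k^j`.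
-/

section Legs

variable {N n : ℕ} {A : Type*}

/-- The matrix `M` acting in the copy number `s` of `V`, the identity in the other copies. -/
def leg1 [Zero A] (s : Fin n) (M : Matrix (Fin N) (Fin N) A) :
    Matrix (Fin n → Fin N) (Fin n → Fin N) A :=
  Matrix.of fun a b => if ∀ r, r ≠ s → a r = b r then M (a s) (b s) else 0

/-- The matrix `R` acting in the copies number `s` and `t` of `V` (used for `s ≠ t`), the identity in
the other copies. -/
def leg2 [Zero A] (s t : Fin n) (R : Matrix (Fin N × Fin N) (Fin N × Fin N) A) :
    Matrix (Fin n → Fin N) (Fin n → Fin N) A :=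
  Matrix.of fun a b => if ∀ r, r ≠ s → r ≠ t → a r = b r then R (a s, a t) (b s, b t) else 0

/-- The matrix `X ⊗ I`: one more copy of `V` is added on the right. -/
def addCopy [Zero A] (X : Matrix (Fin n → Fin N) (Fin n → Fin N) A) :
    Matrix (Fin (n + 1) → Fin N) (Fin (n + 1) → Fin N) A :=
  Matrix.of fun a b =>
    if a (Fin.last n) = b (Fin.last n) then X (Fin.init a) (Fin.init b) else 0

end Legs

section Symmetry

variable {K : Type*} [Field K] {N : ℕ}

/-- The `q`-integer `k_q = (q^k - q^{-k}) / (q - q^{-1})`. -/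
def qint (q : K) (k : ℕ) : K := (q ^ k - q⁻¹ ^ k) / (q - q⁻¹)

/-- The braid relation `R₁₂ R₂₃ R₁₂ = R₂₃ R₁₂ R₂₃` in `V ⊗ V ⊗ V`. -/
def IsBraiding (R : Matrix (Fin N × Fin N) (Fin N × Fin N) K) : Prop :=
  leg2 (n := 3) 0 1 R * leg2 1 2 R * leg2 0 1 R = leg2 1 2 R * leg2 0 1 R * leg2 1 2 R

/-- `R` is a Hecke symmetry: a braiding with `(q I - R) (q⁻¹ I + R) = 0`. -/
structure IsHeckeSymmetry (q : K) (R : Matrix (Fin N × Fin N) (Fin N × Fin N) K) : Prop where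
  braiding : IsBraiding R
  hecke : (q • (1 : Matrix (Fin N × Fin N) (Fin N × Fin N) K) - R) *
    (q⁻¹ • (1 : Matrix (Fin N × Fin N) (Fin N × Fin N) K) + R) = 0

/-- `q` is generic: `q ≠ 0` and `q` is not a root of unity. -/
def IsGeneric (q : K) : Prop := q ≠ 0 ∧ ∀ n : ℕ, 1 ≤ n → q ^ n ≠ 1

/-- `Tr₂ R₁₂ Ψ₂₃ = P₁₃`, that is `R_{ij}^{kl} Ψ_{lp}^{jr} = δ_i^r δ_p^k`.  A braiding is
skew-invertible if it has such a `Ψ`. -/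
def IsSkewInverse (R Ψ : Matrix (Fin N × Fin N) (Fin N × Fin N) K) : Prop :=
  ∀ i k p r : Fin N,
    ∑ j, ∑ l, R (i, j) (k, l) * Ψ (l, p) (j, r) = if i = r ∧ p = k then 1 else 0

/-- `C = Tr₂ Ψ`, that is `C_i^j = Ψ_{ik}^{jk}`. -/
def matC (Ψ : Matrix (Fin N × Fin N) (Fin N × Fin N) K) : Matrix (Fin N) (Fin N) K :=
  Matrix.of fun i j => ∑ k, Ψ (i, k) (j, k)

/-- The skew-symmetrizer `P_-^{(k)}` in `V^{⊗ k}`: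
`P_-^{(1)} = I` and `P_-^{(k)} = (1 / k_q) P_-^{(k-1)} (q^{k-1} I - (k-1)_q R_{k-1}) P_-^{(k-1)}`,
where `P_-^{(k-1)}` acts in the first `k - 1` copies of `V` and `R_{k-1}` in the last two. -/
def skewSymmetrizer (q : K) (R : Matrix (Fin N × Fin N) (Fin N × Fin N) K) :
    (k : ℕ) → Matrix (Fin k → Fin N) (Fin k → Fin N) K
  | 0 => 1
  | 1 => 1
  | k + 2 => (qint q (k + 2))⁻¹ • (addCopy (skewSymmetrizer q R (k + 1)) *
      (q ^ (k + 1) • (1 : Matrix (Fin (k + 2) → Fin N) (Fin (k + 2) → Fin N) K)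
        - qint q (k + 1) • leg2 (Fin.last k).castSucc (Fin.last (k + 1)) R) *
      addCopy (skewSymmetrizer q R (k + 1)))

/-- The degree `k` part of the two-sided ideal of the tensor algebra `T(V)` generated by the image of
`q⁻¹ I + R` in `V ⊗ V`: the sum of the images in `V^{⊗ k}` of `q⁻¹ I + R` acting in neighbouring
copies.  (A tensor is the row of its coordinates, so an operator acts by `Matrix.vecMul`.) -/
def exteriorRelations (q : K) (R : Matrix (Fin N × Fin N) (Fin N × Fin N) K) (k : ℕ) :
    Submodule K ((Fin k → Fin N) → K) :=
  ⨆ (s : Fin k) (t : Fin k) (_ : (t : ℕ) = (s : ℕ) + 1), LinearMap.range (Matrix.vecMulLinear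
    (q⁻¹ • (1 : Matrix (Fin k → Fin N) (Fin k → Fin N) K) + leg2 s t R))

/-- The Poincaré–Hilbert series `P_-(t) = ∑_k dim Λ_R^{(k)}(V) t^k` of the `R`-skew-symmetric algebra
`Λ_R(V) = T(V) / ⟨Im (q⁻¹ I + R)⟩`. -/
noncomputable def poincareSeries (q : K) (R : Matrix (Fin N × Fin N) (Fin N × Fin N) K) : ℚ⟦X⟧ :=
  PowerSeries.mk fun k =>
    (Module.finrank K (((Fin k → Fin N) → K) ⧸ exteriorRelations q R k) : ℚ)

/-- The bi-rank of `R` is `(m|n)`: `P_-(t) = f(t) / g(t)` with coprime polynomials `f` of degree `m`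
and `g` of degree `n`. -/
def HasBiRank (q : K) (R : Matrix (Fin N × Fin N) (Fin N × Fin N) K) (m n : ℕ) : Prop :=
  ∃ f g : Polynomial ℚ, IsCoprime f g ∧ f.natDegree = m ∧ g.natDegree = n ∧
    (g : ℚ⟦X⟧) * poincareSeries q R = (f : ℚ⟦X⟧)

end Symmetry

section Yangian

variable {K : Type*} [Field K] {N : ℕ}

/-- The coefficients of `L(u) = ∑_k L[k] u^{-k}` in the free algebra on the letters `l_i^j[k]`, `k ≥ 1`
(the letter `(i, j, k)` is `l_i^j[k + 1]`): `L[0] = I`, and `L[k] = 0` for `k < 0`. -/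
def freeL (K : Type*) [Field K] (N : ℕ) :
    ℤ → Matrix (Fin N) (Fin N) (FreeAlgebra K (Fin N × Fin N × ℕ))
  | Int.ofNat 0 => 1
  | Int.ofNat (k + 1) => Matrix.of fun i j => FreeAlgebra.ι K (i, j, k)
  | Int.negSucc _ => 0

/-- The coefficient `L₁[k]`: `L[k]` acting in the first of two copies of `V`. -/
def freeL1 (K : Type*) [Field K] (N : ℕ) (k : ℤ) :
    Matrix (Fin 2 → Fin N) (Fin 2 → Fin N) (FreeAlgebra K (Fin N × Fin N × ℕ)) :=
  leg1 0 (freeL K N k)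

/-- A matrix over `K` with its entries regarded as elements of an algebra `A`. -/
def coeMat {ι A : Type*} [Ring A] [Algebra K A] (M : Matrix ι ι K) : Matrix ι ι A :=
  M.map (algebraMap K A)

/-- The coefficient of `u^{-a} v^{-b}` in `(u - v) R(u,v) L₁(u) R L₁(v)`, where
`(u - v) R(u,v) = (u - v) R - (q - q⁻¹) u I`. -/
def yangianLeft (q : K) (R : Matrix (Fin N × Fin N) (Fin N × Fin N) K) (a b : ℤ) :
    Matrix (Fin 2 → Fin N) (Fin 2 → Fin N) (FreeAlgebra K (Fin N × Fin N × ℕ)) :=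
  coeMat (leg2 0 1 R) * freeL1 K N (a + 1) * coeMat (leg2 0 1 R) * freeL1 K N b
    - coeMat (leg2 0 1 R) * freeL1 K N a * coeMat (leg2 0 1 R) * freeL1 K N (b + 1)
    - (q - q⁻¹) • (freeL1 K N (a + 1) * coeMat (leg2 0 1 R) * freeL1 K N b)

/-- The coefficient of `u^{-a} v^{-b}` in `L₁(v) R L₁(u) R(u,v) (u - v)`. -/
def yangianRight (q : K) (R : Matrix (Fin N × Fin N) (Fin N × Fin N) K) (a b : ℤ) :
    Matrix (Fin 2 → Fin N) (Fin 2 → Fin N) (FreeAlgebra K (Fin N × Fin N × ℕ)) :=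
  freeL1 K N b * coeMat (leg2 0 1 R) * freeL1 K N (a + 1) * coeMat (leg2 0 1 R)
    - freeL1 K N (b + 1) * coeMat (leg2 0 1 R) * freeL1 K N a * coeMat (leg2 0 1 R)
    - (q - q⁻¹) • (freeL1 K N b * coeMat (leg2 0 1 R) * freeL1 K N (a + 1))

/-- The defining relations `R(u,v) L₁(u) R L₁(v) = L₁(v) R L₁(u) R(u,v)` of the braided Yangian, with
`R(u,v) = R - (q - q⁻¹) u / (u - v) I`, multiplied by `u - v` and compared coefficientwise. -/
inductive YangianRel (q : K) (R : Matrix (Fin N × Fin N) (Fin N × Fin N) K) :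
    FreeAlgebra K (Fin N × Fin N × ℕ) → FreeAlgebra K (Fin N × Fin N × ℕ) → Prop
  | mk (a b : ℤ) (i j : Fin 2 → Fin N) :
      YangianRel q R (yangianLeft q R a b i j) (yangianRight q R a b i j)

/-- The braided Yangian `Y(R)`: the unital associative algebra generated by the `l_i^j[k]`, `k ≥ 1`,
subject to the relations above. -/
abbrev Yangian (q : K) (R : Matrix (Fin N × Fin N) (Fin N × Fin N) K) : Type _ :=
  RingQuot (YangianRel q R)

/-- The generating matrix `L(u) = ∑_{k ≥ 0} L[k] u^{-k}` of the braided Yangian.  The power series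
variable stands for `u⁻¹`. -/
noncomputable def genMatrix (q : K) (R : Matrix (Fin N × Fin N) (Fin N × Fin N) K) :
    Matrix (Fin N) (Fin N) (Yangian q R)⟦X⟧ :=
  Matrix.of fun i j => PowerSeries.mk fun k : ℕ =>
    RingQuot.mkAlgHom K (YangianRel q R) (freeL K N (k : ℤ) i j)

end Yangian

section Identities

variable {K : Type*} [Field K] {N n : ℕ} {A : Type*} [Ring A] [Algebra K A]

/-- `f(u) ↦ f(c u)` for a series `f` in `u⁻¹` (`c ≠ 0`). -/
noncomputable def scaleArg (c : K) (f : A⟦X⟧) : A⟦X⟧ :=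
  PowerSeries.mk fun n => (c⁻¹ ^ n) • PowerSeries.coeff n f

/-- `f(u) ↦ f(q^{-2j} u)`. -/
noncomputable def shift (q : K) (j : ℕ) (f : A⟦X⟧) : A⟦X⟧ := scaleArg (q ^ (-2 * (j : ℤ))) f

/-- The matrix `L_{\overline{k+1}}` in `k + 1` copies of `V`: `L_{\overline 1} = L₁` and
`L_{\overline{k+1}} = R_k L_{\overline k} R_k⁻¹`. -/
noncomputable def lbar (R : Matrix (Fin N × Fin N) (Fin N × Fin N) K)
    (L : Matrix (Fin N) (Fin N) A⟦X⟧) :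
    (k : ℕ) → Matrix (Fin (k + 1) → Fin N) (Fin (k + 1) → Fin N) A⟦X⟧
  | 0 => leg1 0 L
  | k + 1 => coeMat (leg2 (Fin.last k).castSucc (Fin.last (k + 1)) R) * addCopy (lbar R L k) *
      coeMat (leg2 (Fin.last k).castSucc (Fin.last (k + 1)) R⁻¹)

/-- The product `L_{\overline 1}(u) L_{\overline 2}(q^{-2} u) … L_{\overline k}(q^{-2(k-1)} u)` in `k`
copies of `V`. -/
noncomputable def lstring (q : K) (R : Matrix (Fin N × Fin N) (Fin N × Fin N) K)
    (L : Matrix (Fin N) (Fin N) A⟦X⟧) :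
    (k : ℕ) → Matrix (Fin k → Fin N) (Fin k → Fin N) A⟦X⟧
  | 0 => 1
  | k + 1 => addCopy (lstring q R L k) * lbar R (L.map (shift q k)) k

/-- The `R`-trace `Tr_R M = Tr (C M)`. -/
noncomputable def rTrace (C : Matrix (Fin N) (Fin N) K) (M : Matrix (Fin N) (Fin N) A⟦X⟧) : A⟦X⟧ :=
  ∑ i, ∑ j, C i j • M j i

/-- The `R`-trace in the last copy of `V`. -/
noncomputable def rTraceLast (C : Matrix (Fin N) (Fin N) K)
    (M : Matrix (Fin (n + 1) → Fin N) (Fin (n + 1) → Fin N) A⟦X⟧) :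
    Matrix (Fin n → Fin N) (Fin n → Fin N) A⟦X⟧ :=
  Matrix.of fun a b => ∑ i, ∑ j, C i j • M (Fin.snoc a j) (Fin.snoc b i)

/-- The `R`-trace `Tr_{R(2 … k+1)}` in all copies of `V` but the first. -/
noncomputable def rTraceTail (C : Matrix (Fin N) (Fin N) K) :
    (k : ℕ) → Matrix (Fin (k + 1) → Fin N) (Fin (k + 1) → Fin N) A⟦X⟧ →
      Matrix (Fin N) (Fin N) A⟦X⟧
  | 0, M => Matrix.of fun i j => M (fun _ => i) (fun _ => j)
  | k + 1, M => rTraceTail C k (rTraceLast C M)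

/-- The power `L^k(u) = L(q^{-2(k-1)} u) L(q^{-2(k-2)} u) … L(u)`, with `L^0(u) = I`. -/
noncomputable def lpow (q : K) (L : Matrix (Fin N) (Fin N) A⟦X⟧) :
    ℕ → Matrix (Fin N) (Fin N) A⟦X⟧
  | 0 => 1
  | k + 1 => L.map (shift q k) * lpow q L k

/-- The skew-power `L^{∧k}(u) = Tr_{R(2 … k)} (P_-^{(k)} L_{\overline 1}(u) L_{\overline 2}(q^{-2} u) …
L_{\overline k}(q^{-2(k-1)} u))` for `k ≥ 1`; in particular `L^{∧1}(u) = L(u)`.  The value at `k = 0` is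
not used. -/
noncomputable def lskew (q : K) (R : Matrix (Fin N × Fin N) (Fin N × Fin N) K)
    (C : Matrix (Fin N) (Fin N) K) (L : Matrix (Fin N) (Fin N) A⟦X⟧) :
    ℕ → Matrix (Fin N) (Fin N) A⟦X⟧
  | 0 => 1
  | k + 1 => rTraceTail C k (coeMat (skewSymmetrizer q R (k + 1)) * lstring q R L (k + 1))

/-- The elementary symmetric functions `e_k(u) = Tr_R L^{∧k}(u)`, `k ≥ 1`, and `e_0(u) = 1`. -/
noncomputable def elem (q : K) (R : Matrix (Fin N × Fin N) (Fin N × Fin N) K)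
    (C : Matrix (Fin N) (Fin N) K) (L : Matrix (Fin N) (Fin N) A⟦X⟧) : ℕ → A⟦X⟧
  | 0 => 1
  | k + 1 => rTrace C (lskew q R C L (k + 1))

/-- The power sums `p_k(u) = Tr_R L^k(u)`. -/
noncomputable def psum (q : K) (C : Matrix (Fin N) (Fin N) K) (L : Matrix (Fin N) (Fin N) A⟦X⟧)
    (k : ℕ) : A⟦X⟧ :=
  rTrace C (lpow q L k)

end Identities

end BraidedYangian

/-! Everything rests on one recursion, `IsStringMatrix.lskew_succ`: `(n+1)_q L^{∧(n+1)}(u) =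
L(q^{-2n}u) (q^n e_n(u) I - n_q L^{∧n}(u))`. Iterating it gives the Cayley–Hamilton–Newton
identities, and their `R`-trace gives the Newton identities. If the bi-rank is `(m|0)`, then
`Λ^{(m+1)} = 0`, which forces `P_-^{(m+1)} = 0`, so the identity of order `m + 1` has zero left
side. Every term on its right side begins with `L(q^{-2m}u)`, whose leading coefficient is `I`, and
this factor can be cancelled.

The recursion has an algebraic and a trace part. At `v = q^{-2m}u`, `m ≥ 1`, the matrix `R(u,v)` is
proportional to the Baxterized generator `q^m - m_q R`, so the defining relations exchange arguments
of neighbouring factors `L_{\overline i}` (`isStringMatrix_genMatrix`,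
`HeckeRelations.stringRelations`). The skew-symmetrizer is, up to a scalar, a smaller
skew-symmetrizer in the copies `2, …, n` times a product of such generators. That product carries
the last argument of the string to the first place (`StringRelations.antisym_mul_stringProd`).
Together with the recursion of `P_-` at its other end, this leaves `L(q^{-2n}u)` times `T (q^n - n_q
R₁) P`, where `P` and the antisymmetrized string `T` live in the later copies.

In the `R`-trace over the copies `2, …, n+1`, the factor `P` may be cycled to the front, because `C
⊗ C` commutes with `R`, and is absorbed there by `T`. No cyclicity for matrices with noncommuting
entries is needed. Finally `T = Z Y Z⁻¹` with `Z = R₁ ⋯ R_n` and `Y` the same string in the first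
copies. The partial trace identities of `R` then evaluate the traces of `T` and `T R₁` as `e_n I`
and `L^{∧n}`. -/

namespace BraidedYangian

/-! ### Nonvanishing and recursion of the `q`-integers. -/

section QInt

variable {K : Type*} [Field K] {q : K}

theorem IsGeneric.sub_inv_ne_zero (hq : IsGeneric q) : q - q⁻¹ ≠ 0 := by
  intro h
  have h2 := hq.2 2 (by norm_num)
  apply h2
  have : q = q⁻¹ := sub_eq_zero.mp h
  rw [sq]
  nth_rewrite 2 [this]
  exact mul_inv_cancel₀ hq.1

theorem IsGeneric.qint_ne_zero (hq : IsGeneric q) {k : ℕ} (hk : k ≠ 0) : qint q k ≠ 0 := by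
  refine div_ne_zero ?_ hq.sub_inv_ne_zero
  intro h
  apply hq.2 (2 * k) (by omega)
  have h1 : q ^ k = q⁻¹ ^ k := sub_eq_zero.mp h
  rw [two_mul, pow_add]
  nth_rewrite 2 [h1]
  rw [← mul_pow, mul_inv_cancel₀ hq.1, one_pow]

@[simp] theorem qint_zero : qint q 0 = 0 := by simp [qint]

theorem IsGeneric.qint_one (hq : IsGeneric q) : qint q 1 = 1 := by
  simp [qint, div_self hq.sub_inv_ne_zero]

theorem IsGeneric.qint_succ (hq : IsGeneric q) (k : ℕ) :
    qint q (k + 1) = q ^ k + q⁻¹ * qint q k := by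
  have h := hq.sub_inv_ne_zero
  have h0 := hq.1
  rw [qint, qint, div_eq_iff h, add_mul, mul_assoc, div_mul_cancel₀ _ h]
  ring

end QInt

/-! ### Antisymmetrizers in the Hecke algebra. -/

section Hecke

variable {K B : Type*} [Field K] [Ring B] [Algebra K B]

/-- The elements `r 0, …, r (M - 1)` satisfy the relations of the Hecke algebra. -/
structure HeckeRelations (q : K) (M : ℕ) (r : ℕ → B) : Prop where
  sq : ∀ i < M, r i * r i = 1 + (q - q⁻¹) • r i
  comm : ∀ i j, i + 1 < j → j < M → r i * r j = r j * r i
  braid : ∀ i, i + 1 < M → r i * r (i + 1) * r i = r (i + 1) * r i * r (i + 1)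

/-- The Baxterized generator `q^m - m_q x`. -/
def baxter (q : K) (m : ℕ) (x : B) : B := q ^ m • (1 : B) - qint q m • x

/-- The antisymmetrizer built from `f 0, …, f (k - 2)`. -/
def antisym (q : K) (f : ℕ → B) : ℕ → B
  | 0 => 1
  | 1 => 1
  | k + 2 => (qint q (k + 2))⁻¹ •
      (antisym q f (k + 1) * baxter q (k + 1) (f k) * antisym q f (k + 1))

variable {q : K} {M : ℕ} {r f g : ℕ → B}

theorem HeckeRelations.mono {M' : ℕ} (h : HeckeRelations q M r) (hM : M' ≤ M) :
    HeckeRelations q M' r :=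
  ⟨fun i hi => h.sq i (by omega), fun i j hij hj => h.comm i j hij (by omega),
    fun i hi => h.braid i (by omega)⟩

theorem HeckeRelations.tail (h : HeckeRelations q (M + 1) r) :
    HeckeRelations q M (fun i => r (i + 1)) :=
  ⟨fun i hi => h.sq _ (by omega), fun i j hij hj => h.comm _ _ (by omega) (by omega),
    fun i hi => h.braid _ (by omega)⟩

theorem HeckeRelations.reverse (h : HeckeRelations q M r) :
    HeckeRelations q M (fun i => r (M - 1 - i)) := by
  refine ⟨fun i hi => h.sq _ (by omega),
    fun i j hij hj => (h.comm _ _ (by omega) (by omega)).symm, fun i hi => ?_⟩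
  have := h.braid (M - 1 - (i + 1)) (by omega)
  rw [show M - 1 - (i + 1) + 1 = M - 1 - i by omega] at this
  exact this.symm

theorem antisym_congr (k : ℕ) (h : ∀ i, i + 1 < k → f i = g i) :
    antisym q f k = antisym q g k := by
  induction k with
  | zero => rfl
  | succ k ih =>
    rcases k with _ | k
    · rfl
    · rw [antisym, antisym, ih fun i hi => h i (by omega), h k (by omega)]

theorem map_antisym {B' : Type*} [Ring B'] [Algebra K B'] (φ : B →ₐ[K] B') (k : ℕ) :
    φ (antisym q f k) = antisym q (fun i => φ (f i)) k := by
  induction k with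
  | zero => simp [antisym]
  | succ k ih =>
    rcases k with _ | k
    · simp [antisym]
    · simp only [antisym, baxter, map_smul, map_mul, ih, map_sub, map_one]

theorem mul_baxter {x y z : B} (m : ℕ) (h : z * x = y * z) :
    z * baxter q m x = baxter q m y * z := by
  simp only [baxter, mul_sub, sub_mul, mul_smul_comm, smul_mul_assoc, mul_one, one_mul, h]

theorem mul_antisym {z : B} (k : ℕ) (h : ∀ i, i + 1 < k → z * f i = g i * z) :
    z * antisym q f k = antisym q g k * z := by
  induction k with
  | zero => simp [antisym]
  | succ k ih =>
    rcases k with _ | k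
    · simp [antisym]
    · have h1 := ih fun i hi => h i (by omega)
      have h2 := mul_baxter (q := q) (k + 1) (h k (by omega))
      rw [antisym, antisym, mul_smul_comm, smul_mul_assoc, ← mul_assoc, ← mul_assoc, h1,
        mul_assoc _ z, h2, ← mul_assoc, mul_assoc _ z, h1, ← mul_assoc]

/-- The Yang–Baxter equation for `q^m - m_q r`, at the parameters `-1, k, k + 1`. -/
theorem baxter_yangBaxter (hq : IsGeneric q) {x y : B} (hx : x * x = 1 + (q - q⁻¹) • x)
    (hy : y * y = 1 + (q - q⁻¹) • y) (hxy : x * y * x = y * x * y) (k : ℕ) :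
    (x + q⁻¹ • 1) * baxter q k y * baxter q (k + 1) x =
      baxter q (k + 1) y * baxter q k x * (y + q⁻¹ • 1) := by
  have h0 := hq.1
  have e1 : x * (y * x) = y * (x * y) := by simpa [mul_assoc] using hxy
  simp only [baxter, hq.qint_succ, mul_sub, sub_mul, mul_add, add_mul, smul_mul_assoc,
    mul_smul_comm, mul_one, one_mul, mul_assoc, smul_smul, smul_sub, smul_add, add_smul, e1, hx, hy]
  match_scalars <;> field_simp <;> ring

theorem baxter_yangBaxter' (hq : IsGeneric q) {x y : B} (hx : x * x = 1 + (q - q⁻¹) • x)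
    (hy : y * y = 1 + (q - q⁻¹) • y) (hxy : x * y * x = y * x * y) (k : ℕ) :
    baxter q (k + 1) x * baxter q k y * (x + q⁻¹ • 1) =
      (y + q⁻¹ • 1) * baxter q k x * baxter q (k + 1) y := by
  have h0 := hq.1
  have e1 : x * (y * x) = y * (x * y) := by simpa [mul_assoc] using hxy
  simp only [baxter, hq.qint_succ, mul_sub, sub_mul, mul_add, add_mul, smul_mul_assoc,
    mul_smul_comm, mul_one, one_mul, mul_assoc, smul_smul, smul_sub, smul_add, add_smul, e1, hx, hy]
  match_scalars <;> field_simp <;> ring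

/-- Where `x` acts as `-q⁻¹`, the Baxterized generator acts as `q^m + q⁻¹ m_q = (m+1)_q`. -/
theorem baxter_mul_of_absorb (hq : IsGeneric q) {x z : B} (m : ℕ) (h : (x + q⁻¹ • 1) * z = 0) :
    baxter q m x * z = qint q (m + 1) • z := by
  have h1 : x * z = -(q⁻¹ • z) := by
    rw [add_mul, smul_mul_assoc, one_mul] at h
    exact eq_neg_of_add_eq_zero_left h
  rw [baxter, sub_mul, smul_mul_assoc, smul_mul_assoc, one_mul, h1, hq.qint_succ]
  module

theorem mul_baxter_of_absorb (hq : IsGeneric q) {x z : B} (m : ℕ) (h : z * (x + q⁻¹ • 1) = 0) :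
    z * baxter q m x = qint q (m + 1) • z := by
  have h1 : z * x = -(q⁻¹ • z) := by
    rw [mul_add, mul_smul_comm, mul_one] at h
    exact eq_neg_of_add_eq_zero_left h
  rw [baxter, mul_sub, mul_smul_comm, mul_smul_comm, mul_one, h1, hq.qint_succ]
  module

/-- The normalization `1 / k_q` is chosen so that the antisymmetrizer is `1` wherever all generators
act as `-q⁻¹`. With `HeckeRelations.antisym_absorb` this contains idempotence. -/
theorem antisym_mul_of_absorb (hq : IsGeneric q) {z : B} (k : ℕ)
    (h : ∀ i, i + 1 < k → (f i + q⁻¹ • 1) * z = 0) : antisym q f k * z = z := by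
  induction k with
  | zero => simp [antisym]
  | succ k ih =>
    rcases k with _ | k
    · simp [antisym]
    · have h1 := ih fun i hi => h i (by omega)
      rw [antisym, smul_mul_assoc, mul_assoc, mul_assoc, h1,
        baxter_mul_of_absorb hq _ (h k (by omega)), mul_smul_comm, h1, smul_smul,
        inv_mul_cancel₀ (hq.qint_ne_zero (by omega)), one_smul]

theorem mul_antisym_of_absorb (hq : IsGeneric q) {z : B} (k : ℕ)
    (h : ∀ i, i + 1 < k → z * (f i + q⁻¹ • 1) = 0) : z * antisym q f k = z := by
  induction k with
  | zero => simp [antisym]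
  | succ k ih =>
    rcases k with _ | k
    · simp [antisym]
    · have h1 := ih fun i hi => h i (by omega)
      rw [antisym, mul_smul_comm, ← mul_assoc, ← mul_assoc, h1,
        mul_baxter_of_absorb hq _ (h k (by omega)), smul_mul_assoc, h1, smul_smul,
        inv_mul_cancel₀ (hq.qint_ne_zero (by omega)), one_smul]

/-- The antisymmetrizer absorbs the generators, on both sides. -/
theorem HeckeRelations.antisym_absorb (hq : IsGeneric q) (k : ℕ) (h : HeckeRelations q (k - 1) f) :
    ∀ i, i + 1 < k → (f i + q⁻¹ • 1) * antisym q f k = 0 ∧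
      antisym q f k * (f i + q⁻¹ • 1) = 0 := by
  induction k with
  | zero => intro i hi; omega
  | succ k ih =>
    rcases k with _ | k
    · intro i hi; omega
    · intro i hi
      have IH := ih (h.mono (by omega))
      rcases Nat.lt_or_ge i k with hik | hik
      · obtain ⟨h1, h2⟩ := IH i (by omega)
        constructor
        · rw [antisym, mul_smul_comm, ← mul_assoc, ← mul_assoc, h1, zero_mul, zero_mul, smul_zero]
        · rw [antisym, smul_mul_assoc, mul_assoc, h2, mul_zero, smul_zero]
      · obtain rfl : i = k := by omega
        rcases i with _ | k
        · have hx := h.sq 0 (by omega)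
          have h0 := hq.1
          simp only [antisym, baxter, mul_one, one_mul, zero_add, hq.qint_one, one_smul, pow_one,
            mul_smul_comm, smul_mul_assoc, mul_sub, sub_mul, add_mul, mul_add, hx]
          constructor <;> match_scalars <;> field_simp <;> ring
        · have hx := h.sq (k + 1) (by omega)
          have hy := h.sq k (by omega)
          have hxy := (h.braid k (by omega)).symm
          obtain ⟨h1, h2⟩ := IH k (by omega)
          have hA : antisym q f (k + 1) * antisym q f (k + 2) = antisym q f (k + 2) :=
            antisym_mul_of_absorb hq _ fun i hi => (IH i (by omega)).1
          have hA' : antisym q f (k + 2) * antisym q f (k + 1) = antisym q f (k + 2) :=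
            mul_antisym_of_absorb hq _ fun i hi => (IH i (by omega)).2
          have hc : f (k + 1) * antisym q f (k + 1) = antisym q f (k + 1) * f (k + 1) :=
            mul_antisym _ fun i hi => (h.comm i (k + 1) (by omega) (by omega)).symm
          have hb := mul_baxter (q := q) (k + 2) hc.symm
          have hd : (f (k + 1) + q⁻¹ • 1) * antisym q f (k + 1) =
              antisym q f (k + 1) * (f (k + 1) + q⁻¹ • 1) := by
            rw [add_mul, mul_add, hc, smul_mul_assoc, mul_smul_comm, one_mul, mul_one]
          have e : antisym q f (k + 2) = (qint q (k + 2))⁻¹ •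
            (antisym q f (k + 1) * baxter q (k + 1) (f k) * antisym q f (k + 1)) := rfl
          set A := antisym q f (k + 1)
          set P := antisym q f (k + 2)
          have h3 : (f (k + 1) + q⁻¹ • 1) *
              (A * baxter q (k + 1) (f k) * A * (baxter q (k + 2) (f (k + 1)) * P)) = 0 := by
            have := baxter_yangBaxter hq hx hy hxy (k + 1)
            calc _ = ((f (k + 1) + q⁻¹ • 1) * A) * baxter q (k + 1) (f k) *
                  (A * baxter q (k + 2) (f (k + 1))) * P := by simp only [mul_assoc]
              _ = A * ((f (k + 1) + q⁻¹ • 1) * baxter q (k + 1) (f k) *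
                  baxter q (k + 2) (f (k + 1))) * (A * P) := by
                rw [hd, hb]; simp only [mul_assoc]
              _ = 0 := by rw [this, hA, mul_assoc, mul_assoc, h1, mul_zero, mul_zero]
          have h4 : (P * baxter q (k + 2) (f (k + 1))) * (A * baxter q (k + 1) (f k) * A) *
              (f (k + 1) + q⁻¹ • 1) = 0 := by
            have := baxter_yangBaxter' hq hx hy hxy (k + 1)
            calc _ = P * (baxter q (k + 2) (f (k + 1)) * A) * baxter q (k + 1) (f k) *
                  (A * (f (k + 1) + q⁻¹ • 1)) := by simp only [mul_assoc]
              _ = (P * A) * (baxter q (k + 2) (f (k + 1)) * baxter q (k + 1) (f k) *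
                  (f (k + 1) + q⁻¹ • 1)) * A := by
                rw [← hd, ← hb]; simp only [mul_assoc]
              _ = 0 := by
                rw [this, hA', ← mul_assoc, ← mul_assoc, h2, zero_mul, zero_mul, zero_mul]
          constructor
          · rw [antisym, mul_smul_comm, mul_assoc _ _ P]
            change _ • ((f (k + 1) + q⁻¹ • 1) * (P * _)) = 0
            nth_rewrite 1 [e]
            rw [smul_mul_assoc, mul_smul_comm, h3, smul_zero, smul_zero]
          · rw [antisym, smul_mul_assoc]
            change _ • (P * _ * P * (f (k + 1) + q⁻¹ • 1)) = 0
            nth_rewrite 2 [e]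
            rw [mul_smul_comm, smul_mul_assoc, h4, smul_zero, smul_zero]

/-- Both antisymmetrizers absorb the same generators, hence each one absorbs the other, and their
product equals both. -/
theorem HeckeRelations.antisym_reverse (hq : IsGeneric q) (k : ℕ)
    (h : HeckeRelations q (k - 1) f) :
    antisym q (fun i => f (k - 1 - 1 - i)) k = antisym q f k := by
  have h1 := h.antisym_absorb hq k
  have h2 := h.reverse.antisym_absorb hq k
  rw [← mul_antisym_of_absorb hq (z := antisym q _ k) k fun i hi => (h1 (k - 1 - 1 - i) (by omega)).2]
  refine (antisym_mul_of_absorb hq k fun i hi => ?_).symm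
  have := (h2 (k - 1 - 1 - i) (by omega)).1
  rwa [show k - 1 - 1 - (k - 1 - 1 - i) = i by omega] at this

/-- The recursion of the antisymmetrizer at its other end. -/
theorem HeckeRelations.antisym_succ (hq : IsGeneric q) (k : ℕ) (h : HeckeRelations q (k + 1) f) :
    antisym q f (k + 2) = (qint q (k + 2))⁻¹ • (antisym q (fun i => f (i + 1)) (k + 1) *
      baxter q (k + 1) (f 0) * antisym q (fun i => f (i + 1)) (k + 1)) := by
  rw [← h.antisym_reverse hq (k + 2), antisym]
  have : antisym q (fun i => f (k + 2 - 1 - 1 - i)) (k + 1) =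
      antisym q (fun i => f (i + 1)) (k + 1) := by
    rw [← h.tail.antisym_reverse hq (k + 1)]
    refine antisym_congr _ fun i hi => ?_
    congr 1; omega
  rw [this]
  simp

end Hecke

/-! ### Exchange relations and antisymmetrized strings. -/

section Strings

variable {K B : Type*} [Field K] [Ring B] [Algebra K B]

/-- The elements `x`, `r₀ x r₀⁻¹`, `r₁ r₀ x r₀⁻¹ r₁⁻¹`, … -/
def conjSeq (r s : ℕ → B) (x : B) : ℕ → B
  | 0 => x
  | i + 1 => r i * conjSeq r s x i * s i

/-- The product `ℓ₀(a) ℓ₁(a + 1) … ℓ_{n-1}(a + n - 1)`. -/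
def stringProd : (ℕ → ℕ → B) → ℕ → ℕ → B
  | _, _, 0 => 1
  | l, a, n + 1 => l 0 a * stringProd (fun i => l (i + 1)) (a + 1) n

/-- The product `R₀(n) R₁(n - 1) … R_{n-1}(1)` of Baxterized generators. -/
def baxterProd (q : K) : (ℕ → B) → ℕ → B
  | _, 0 => 1
  | r, n + 1 => baxter q (n + 1) (r 0) * baxterProd q (fun i => r (i + 1)) n

/-- The Hecke generators `r i` together with matrices `l i a` of generators, the parameter `a`
standing for the argument `q^{-2a} u`. -/
structure StringRelations (q : K) (M : ℕ) (r : ℕ → B) (l : ℕ → ℕ → B) : Prop where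
  hecke : HeckeRelations q M r
  comm : ∀ i j a, j < M → i ≤ M → j ≠ i → j + 1 ≠ i → r j * l i a = l i a * r j
  rel : ∀ i < M, ∀ a m, baxter q m (r i) * (l i a * l (i + 1) (a + m)) =
    l i (a + m) * l (i + 1) a * baxter q m (r i)

variable {q : K} {M : ℕ} {r s : ℕ → B} {l l' : ℕ → ℕ → B}

theorem StringRelations.mono {M' : ℕ} (h : StringRelations q M r l) (hM : M' ≤ M) :
    StringRelations q M' r l :=
  ⟨h.hecke.mono hM, fun i j a hj hi => h.comm i j a (by omega) (by omega),
    fun i hi => h.rel i (by omega)⟩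

theorem StringRelations.tail (h : StringRelations q (M + 1) r l) :
    StringRelations q M (fun i => r (i + 1)) (fun i => l (i + 1)) :=
  ⟨h.hecke.tail, fun i j a hj hi h1 h2 => h.comm _ _ a (by omega) (by omega) (by omega) (by omega),
    fun i hi => h.rel _ (by omega)⟩

theorem stringProd_add (m n : ℕ) (a : ℕ) :
    stringProd l a (m + n) = stringProd l a m * stringProd (fun i => l (m + i)) (a + m) n := by
  induction m generalizing l a with
  | zero => simp [stringProd]
  | succ m ih =>
    rw [show m + 1 + n = (m + n) + 1 by omega, stringProd, ih, stringProd, mul_assoc]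
    simp only [add_assoc, add_comm 1]

theorem stringProd_succ (n a : ℕ) :
    stringProd l a (n + 1) = stringProd l a n * l n (a + n) := by
  rw [stringProd_add]; simp [stringProd]

theorem mul_stringProd {z : B} (n a : ℕ) (h : ∀ i < n, ∀ a, z * l i a = l' i a * z) :
    z * stringProd l a n = stringProd l' a n * z := by
  induction n generalizing a with
  | zero => simp [stringProd]
  | succ n ih =>
    rw [stringProd_succ, stringProd_succ, ← mul_assoc, ih _ fun i hi => h i (by omega), mul_assoc,
      h n (by omega), mul_assoc]

theorem baxterProd_mul {z : B} (n : ℕ) (h : ∀ i < n, z * r i = r i * z) :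
    z * baxterProd q r n = baxterProd q r n * z := by
  induction n generalizing r with
  | zero => simp [baxterProd]
  | succ n ih =>
    rw [baxterProd, ← mul_assoc, mul_baxter _ (h 0 (by omega)), mul_assoc,
      ih fun i hi => h (i + 1) (by omega), mul_assoc]

/-- The factors of a string are shifted cyclically by the product of Baxterized generators. -/
theorem StringRelations.baxterProd_mul_stringProd (n : ℕ) (h : StringRelations q n r l) (a : ℕ) :
    baxterProd q r n * stringProd l a (n + 1) =
      l 0 (a + n) * stringProd (fun i => l (i + 1)) a n * baxterProd q r n := by
  induction n generalizing r l a with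
  | zero => simp [baxterProd, stringProd]
  | succ n ih =>
    have h1 : l 0 a * baxterProd q (fun i => r (i + 1)) n =
        baxterProd q (fun i => r (i + 1)) n * l 0 a :=
      baxterProd_mul n fun i hi => (h.comm 0 (i + 1) a (by omega) (by omega) (by omega)
        (by omega)).symm
    have h2 : baxter q (n + 1) (r 0) * stringProd (fun i => l (i + 1 + 1)) (a + 1) n =
        stringProd (fun i => l (i + 1 + 1)) (a + 1) n * baxter q (n + 1) (r 0) := by
      refine mul_stringProd n _ fun i hi b => ?_
      exact (mul_baxter (z := l (i + 1 + 1) b) _ (h.comm (i + 1 + 1) 0 b (by omega) (by omega)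
        (by omega) (by omega)).symm).symm
    have h3 := h.rel 0 (by omega) a (n + 1)
    rw [stringProd, baxterProd, mul_assoc, ← mul_assoc _ (l 0 a), ← h1, mul_assoc (l 0 a),
      ih h.tail, stringProd, show a + 1 + n = a + (n + 1) by omega]
    calc _ = baxter q (n + 1) (r 0) * (l 0 a * l (0 + 1) (a + (n + 1))) *
          stringProd (fun i => l (i + 1 + 1)) (a + 1) n *
          baxterProd q (fun i => r (i + 1)) n := by simp only [mul_assoc]
      _ = _ := by rw [h3, mul_assoc _ (baxter _ _ _), h2]; simp only [mul_assoc, zero_add]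

/-- The antisymmetrizer as a product of Baxterized generators, up to a scalar. -/
theorem HeckeRelations.antisym_eq_baxterProd (hq : IsGeneric q) (n : ℕ)
    (h : HeckeRelations q n r) :
    ∃ c : K, antisym q r (n + 1) =
      c • (antisym q (fun i => r (i + 1)) n * baxterProd q r n) := by
  induction n generalizing r with
  | zero => exact ⟨1, by simp [antisym, baxterProd]⟩
  | succ n ih =>
    obtain ⟨c, hc⟩ := ih h.tail
    refine ⟨(qint q (n + 2))⁻¹ * c, ?_⟩
    have h1 : antisym q (fun i => r (i + 1)) (n + 1) * antisym q (fun i => r (i + 1 + 1)) n =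
        antisym q (fun i => r (i + 1)) (n + 1) :=
      mul_antisym_of_absorb hq _ fun i hi => (h.tail.antisym_absorb hq (n + 1) (i + 1)
        (by omega)).2
    have h2 : baxter q (n + 1) (r 0) * antisym q (fun i => r (i + 1 + 1)) n =
        antisym q (fun i => r (i + 1 + 1)) n * baxter q (n + 1) (r 0) :=
      mul_antisym n fun i hi => (mul_baxter _ (h.comm 0 (i + 1 + 1) (by omega)
        (by omega)).symm).symm
    -- Only the second inner antisymmetrizer is expanded by induction. The smaller one this produces
    -- commutes past `baxter (r 0)` and disappears into the first.
    rw [h.antisym_succ hq]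
    nth_rewrite 2 [hc]
    rw [mul_smul_comm, smul_smul, baxterProd, mul_assoc, ← mul_assoc (baxter _ _ _), h2]
    nth_rewrite 2 [← h1]
    simp only [mul_assoc]

/-- Neighbouring arguments of the string differ by one step, so `q - r i` passes through it with the
two arguments exchanged, and meets `r i + q⁻¹` on the other side. The product of these two is zero.
-/
theorem StringRelations.antisym_mul_stringProd_absorb (hq : IsGeneric q) (n : ℕ)
    (h : StringRelations q (n - 1) r l) (a : ℕ) :
    antisym q r n * stringProd l a n * antisym q r n = antisym q r n * stringProd l a n := by
  refine mul_antisym_of_absorb hq n fun i hi => ?_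
  obtain ⟨m, rfl⟩ : ∃ m, n = i + (2 + m) := ⟨n - i - 2, by omega⟩
  -- On the right of the antisymmetrizer `q - r i` acts as `2_q`, so this factor can be inserted for
  -- free.
  have hP : antisym q r (i + (2 + m)) = (qint q 2)⁻¹ •
      (antisym q r (i + (2 + m)) * baxter q 1 (r i)) := by
    rw [mul_baxter_of_absorb hq 1 (h.hecke.antisym_absorb hq _ i (by omega)).2, smul_smul,
      inv_mul_cancel₀ (hq.qint_ne_zero (by omega)), one_smul]
  have h0 : baxter q 1 (r i) * (r i + q⁻¹ • 1) = 0 := by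
    have hx := h.hecke.sq i (by omega)
    have h0 := hq.1
    simp only [baxter, hq.qint_one, one_smul, pow_one, sub_mul, mul_add, hx, smul_mul_assoc,
      mul_smul_comm, one_mul, mul_one]
    match_scalars <;> field_simp <;> ring
  have h1 : baxter q 1 (r i) * stringProd l a i = stringProd l a i * baxter q 1 (r i) :=
    mul_stringProd _ _ fun j hj b => (mul_baxter _ (h.comm j i b (by omega) (by omega)
      (by omega) (by omega)).symm).symm
  have h2 : (r i + q⁻¹ • 1) * stringProd (fun j => l (i + (2 + j))) (a + i + 2) m =
      stringProd (fun j => l (i + (2 + j))) (a + i + 2) m * (r i + q⁻¹ • 1) :=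
    mul_stringProd _ _ fun j hj b => by
      rw [add_mul, mul_add, h.comm (i + (2 + j)) i b (by omega) (by omega) (by omega) (by omega),
        smul_mul_assoc, mul_smul_comm, one_mul, mul_one]
  have h3 := h.rel i (by omega) (a + i) 1
  rw [stringProd_add, stringProd_add, hP, smul_mul_assoc, smul_mul_assoc]
  have h4 : stringProd (fun j => l (i + j)) (a + i) 2 = l i (a + i) * l (i + 1) (a + i + 1) := by
    simp [stringProd]
  rw [h4]
  calc _ = (qint q 2)⁻¹ • (antisym q r (i + (2 + m)) * (baxter q 1 (r i) * stringProd l a i) *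
        (l i (a + i) * l (i + 1) (a + i + 1)) *
        (stringProd (fun j => l (i + (2 + j))) (a + i + 2) m * (r i + q⁻¹ • 1))) := by
          simp only [mul_assoc]
    _ = (qint q 2)⁻¹ • (antisym q r (i + (2 + m)) * stringProd l a i * (baxter q 1 (r i) *
        (l i (a + i) * l (i + 1) (a + i + 1))) * ((r i + q⁻¹ • 1) *
        (stringProd (fun j => l (i + (2 + j))) (a + i + 2) m))) := by
          rw [h1, h2]; simp only [mul_assoc]
    _ = 0 := by
      rw [h3, ← mul_assoc _ (r i + _), mul_assoc _ _ (r i + _), mul_assoc _ _ (r i + _), h0]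
      simp

/-- An antisymmetrized string is an antisymmetrized string of smaller length, multiplied by the last
factor moved to the first place. -/
theorem StringRelations.antisym_mul_stringProd (hq : IsGeneric q) (n : ℕ)
    (h : StringRelations q n r l) (a : ℕ) :
    antisym q r (n + 1) * stringProd l a (n + 1) =
      l 0 (a + n) * (antisym q (fun i => r (i + 1)) n * stringProd (fun i => l (i + 1)) a n) *
        antisym q r (n + 1) := by
  obtain ⟨c, hc⟩ := h.hecke.antisym_eq_baxterProd hq
  have h1 : l 0 (a + n) * antisym q (fun i => r (i + 1)) n =
      antisym q (fun i => r (i + 1)) n * l 0 (a + n) :=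
    mul_antisym n fun i hi => (h.comm 0 (i + 1) _ (by omega) (by omega) (by omega)
      (by omega)).symm
  have h2 : antisym q (fun i => r (i + 1)) n * stringProd (fun i => l (i + 1)) a n *
      antisym q (fun i => r (i + 1)) n =
      antisym q (fun i => r (i + 1)) n * stringProd (fun i => l (i + 1)) a n := by
    rcases n with _ | n
    · simp [antisym]
    · exact (h.tail.mono (by omega)).antisym_mul_stringProd_absorb hq _ a
  rw [hc, smul_mul_assoc, mul_assoc, h.baxterProd_mul_stringProd, mul_smul_comm]
  congr 1
  -- The smaller antisymmetrizer is repeated behind the shifted string, where it joins `baxterProd`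
  -- to rebuild the full one.
  rw [← mul_assoc, ← mul_assoc, ← h1, mul_assoc (l 0 _)]
  nth_rewrite 1 [← h2]
  simp only [mul_assoc]

/-- An antisymmetrized string in terms of a shorter one. -/
theorem StringRelations.antisym_mul_stringProd_eq (hq : IsGeneric q) (k : ℕ)
    (h : StringRelations q (k + 1) r l) (a : ℕ) :
    antisym q r (k + 2) * stringProd l a (k + 2) = (qint q (k + 2))⁻¹ • (l 0 (a + (k + 1)) *
      (antisym q (fun i => r (i + 1)) (k + 1) * stringProd (fun i => l (i + 1)) a (k + 1) *
        baxter q (k + 1) (r 0) * antisym q (fun i => r (i + 1)) (k + 1))) := by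
  have hPX := h.tail.antisym_mul_stringProd_absorb hq (k + 1) a
  rw [h.antisym_mul_stringProd hq (k + 1) a, h.hecke.antisym_succ hq, mul_smul_comm]
  nth_rewrite 2 [← hPX]
  simp only [mul_assoc]

end Strings

/-! ### The sequence `L_{\overline k}` inside an algebra with Hecke generators. -/

section ConjSeq

variable {K B : Type*} [Field K] [Ring B] [Algebra K B]
variable {q : K} {M : ℕ} {r s : ℕ → B}

theorem HeckeRelations.conjSeq_comm (h : HeckeRelations q M r)
    (hrs : ∀ i < M, r i * s i = 1) (hsr : ∀ i < M, s i * r i = 1) {x : B}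
    (hx : ∀ j, 1 ≤ j → j < M → r j * x = x * r j) (i j : ℕ) (hj : j < M) (hi : i ≤ M)
    (h1 : j ≠ i) (h2 : j + 1 ≠ i) : r j * conjSeq r s x i = conjSeq r s x i * r j := by
  have inv_comm : ∀ k < M, ∀ y z, y * r k = r k * z → z * s k = s k * y := by
    intro k hk y z hyz
    calc z * s k = s k * (r k * z) * s k := by rw [← mul_assoc (s k), hsr k hk, one_mul]
      _ = s k * y := by rw [← hyz, mul_assoc, mul_assoc, hrs k hk, mul_one]
  induction i using Nat.strong_induction_on generalizing j with
  | _ i ih =>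
    rcases i with _ | i
    · exact hx j (by omega) hj
    · by_cases hji : j + 1 = i
      · subst hji
        -- Here the sequence element is `r (j+1) * r j * conjSeq r s x j * s j * s (j+1)`. The braid
        -- relation turns `r j` on the left into `r (j+1)`, which commutes with the middle factor
        -- and turns back into `r j` on the right.
        have hb := h.braid j (by omega)
        have hl := ih j (by omega) (j + 1) (by omega) (by omega) (by omega) (by omega)
        have h3 : r (j + 1) * (s j * s (j + 1)) = s j * s (j + 1) * r j := by
          calc r (j + 1) * (s j * s (j + 1))
              = (s j * s (j + 1) * (r (j + 1) * r j)) * r (j + 1) * (s j * s (j + 1)) := by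
                rw [mul_assoc (s j), ← mul_assoc (s (j + 1)), hsr _ (by omega), one_mul,
                  hsr _ (by omega), one_mul]
            _ = s j * s (j + 1) * (r j * r (j + 1) * r j) * (s j * s (j + 1)) := by
                rw [hb]; simp only [mul_assoc]
            _ = s j * s (j + 1) * r j * (r (j + 1) * (r j * s j) * s (j + 1)) := by
                simp only [mul_assoc]
            _ = _ := by rw [hrs _ (by omega), mul_one, hrs _ (by omega), mul_one]
        rw [conjSeq, conjSeq]
        calc _ = (r j * r (j + 1) * r j) * conjSeq r s x j * (s j * s (j + 1)) := by
              simp only [mul_assoc]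
          _ = r (j + 1) * r j * (r (j + 1) * conjSeq r s x j) * (s j * s (j + 1)) := by
              rw [hb]; simp only [mul_assoc]
          _ = r (j + 1) * r j * conjSeq r s x j * (r (j + 1) * (s j * s (j + 1))) := by
              rw [hl]; simp only [mul_assoc]
          _ = _ := by rw [h3]; simp only [mul_assoc]
      · have hl := ih i (by omega) j hj (by omega) (by omega) (by omega)
        have hc : r j * r i = r i * r j := by
          rcases Nat.lt_or_ge i j with hij | hij
          · exact (h.comm i j (by omega) hj).symm
          · exact h.comm j i (by omega) (by omega)
        have hs := inv_comm i (by omega) _ _ hc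
        rw [conjSeq, ← mul_assoc, ← mul_assoc, hc, mul_assoc (r i), hl, mul_assoc _ _ (s i),
          mul_assoc _ _ (s i), hs]
        simp only [mul_assoc]

theorem conjSeq_mul (hsr : ∀ i < M, s i * r i = 1) (x : B) {i : ℕ} (hi : i < M) :
    conjSeq r s x (i + 1) * r i = r i * conjSeq r s x i := by
  rw [conjSeq, mul_assoc, hsr i hi, mul_one]

/-- Conjugation by `r i * r (i+1)` carries `r i` and the sequence elements at `i`, `i+1` to those
with indices one higher. The exchange relation is therefore needed only at the first place. -/
theorem HeckeRelations.stringRelations (h : HeckeRelations q M r)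
    (hrs : ∀ i < M, r i * s i = 1) (hsr : ∀ i < M, s i * r i = 1) {x : ℕ → B}
    (hx : ∀ a j, 1 ≤ j → j < M → r j * x a = x a * r j)
    (hrel : 0 < M → ∀ a m, baxter q m (r 0) * (x a * (r 0 * x (a + m) * s 0)) =
      x (a + m) * (r 0 * x a * s 0) * baxter q m (r 0)) :
    StringRelations q M r (fun i a => conjSeq r s (x a) i) := by
  refine ⟨h, fun i j a => h.conjSeq_comm hrs hsr (hx a) i j, fun i hi => ?_⟩
  induction i with
  | zero => intro a m; exact hrel (by omega) a m
  | succ i ih =>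
    intro a m
    have g0 : ∀ a, r i * r (i + 1) * conjSeq r s (x a) i =
        conjSeq r s (x a) (i + 1) * (r i * r (i + 1)) := fun a => by
      rw [mul_assoc, h.conjSeq_comm hrs hsr (hx a) i (i + 1) (by omega) (by omega) (by omega)
        (by omega), ← mul_assoc, ← mul_assoc, conjSeq_mul hsr _ (by omega)]
    have g1 : ∀ a, r i * r (i + 1) * conjSeq r s (x a) (i + 1) =
        conjSeq r s (x a) (i + 1 + 1) * (r i * r (i + 1)) := fun a => by
      rw [mul_assoc, ← conjSeq_mul hsr _ hi, ← mul_assoc, ← mul_assoc,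
        h.conjSeq_comm hrs hsr (hx a) (i + 2) i (by omega) (by omega) (by omega) (by omega)]
    have gr : ∀ m, r i * r (i + 1) * baxter q m (r i) =
        baxter q m (r (i + 1)) * (r i * r (i + 1)) := fun m => by
      refine mul_baxter _ ?_
      rw [h.braid i hi, mul_assoc]
    have inv : r i * r (i + 1) * (s (i + 1) * s i) = 1 := by
      rw [mul_assoc, ← mul_assoc _ _ (s i), hrs _ hi, one_mul, hrs _ (by omega)]
    have hL : SemiconjBy (r i * r (i + 1)) _ _ :=
      SemiconjBy.mul_right (gr m) (SemiconjBy.mul_right (g0 a) (g1 (a + m)))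
    have hR : SemiconjBy (r i * r (i + 1)) _ _ :=
      SemiconjBy.mul_right (SemiconjBy.mul_right (g0 (a + m)) (g1 a)) (gr m)
    rw [ih (by omega) a m] at hL
    have key := congrArg (· * (s (i + 1) * s i)) (hL.eq.symm.trans hR.eq)
    rwa [mul_assoc _ (r i * r (i + 1)), inv, mul_one, mul_assoc _ (r i * r (i + 1)), inv,
      mul_one] at key

/-- The product `r₀ r₁ … r_{n-1}`. -/
def ascProd (r : ℕ → B) : ℕ → B
  | 0 => 1
  | n + 1 => ascProd r n * r n

/-- The product `s_{n-1} … s₁ s₀`. -/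
def descProd (s : ℕ → B) : ℕ → B
  | 0 => 1
  | n + 1 => s n * descProd s n

theorem ascProd_mul_descProd (hrs : ∀ i < M, r i * s i = 1) (n : ℕ) (hn : n ≤ M) :
    ascProd r n * descProd s n = 1 := by
  induction n with
  | zero => simp [ascProd, descProd]
  | succ n ih =>
    rw [ascProd, descProd, mul_assoc, ← mul_assoc (r n), hrs n (by omega), one_mul, ih (by omega)]

theorem descProd_succ (n : ℕ) : descProd s (n + 1) = descProd (fun i => s (i + 1)) n * s 0 := by
  induction n with
  | zero => simp [descProd]
  | succ n ih => rw [descProd, ih, descProd, mul_assoc]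

theorem mul_ascProd {z : B} (n : ℕ) (h : ∀ i < n, z * r i = r i * z) :
    z * ascProd r n = ascProd r n * z := by
  induction n with
  | zero => simp [ascProd]
  | succ n ih =>
    rw [ascProd, ← mul_assoc, ih fun i hi => h i (by omega), mul_assoc, h n (by omega), mul_assoc]

theorem HeckeRelations.ascProd_mul (h : HeckeRelations q M r) (n i : ℕ) (hn : n ≤ M)
    (hi : i + 1 < n) : ascProd r n * r i = r (i + 1) * ascProd r n := by
  induction n with
  | zero => omega
  | succ n ih =>
    rcases Nat.lt_or_ge (i + 1) n with hin | hin
    · rw [ascProd, mul_assoc, ← h.comm i n hin (by omega), ← mul_assoc, ih (by omega) hin,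
        mul_assoc]
    · obtain rfl : n = i + 1 := by omega
      have h1 : r (i + 1) * ascProd r i = ascProd r i * r (i + 1) :=
        mul_ascProd i fun j hj => (h.comm j (i + 1) (by omega) (by omega)).symm
      simp only [ascProd]
      calc _ = ascProd r i * (r i * r (i + 1) * r i) := by simp only [mul_assoc]
        _ = (ascProd r i * r (i + 1)) * (r i * r (i + 1)) := by
          rw [h.braid i (by omega)]; simp only [mul_assoc]
        _ = _ := by rw [← h1]; simp only [mul_assoc]

/-- With `HeckeRelations.ascProd_mul`, this makes conjugation by `Z = r₀ ⋯ r_{n-1}` the translation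
of a whole antisymmetrized string by one place. -/
theorem HeckeRelations.ascProd_mul_conjSeq (h : HeckeRelations q M r)
    (hrs : ∀ i < M, r i * s i = 1) (hsr : ∀ i < M, s i * r i = 1) {x : B}
    (hx : ∀ j, 1 ≤ j → j < M → r j * x = x * r j) (n i : ℕ) (hn : n ≤ M) (hi : i < n) :
    ascProd r n * conjSeq r s x i = conjSeq r s x (i + 1) * ascProd r n := by
  induction n with
  | zero => omega
  | succ n ih =>
    rcases Nat.lt_or_ge i n with hin | hin
    · rw [ascProd, mul_assoc, h.conjSeq_comm hrs hsr hx i n (by omega) (by omega) (by omega)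
        (by omega), ← mul_assoc, ih (by omega) hin, mul_assoc]
    · obtain rfl : n = i := by omega
      have h1 : conjSeq r s x (n + 1) * ascProd r n = ascProd r n * conjSeq r s x (n + 1) :=
        mul_ascProd n fun j hj => (h.conjSeq_comm hrs hsr hx (n + 1) j (by omega) (by omega)
          (by omega) (by omega)).symm
      rw [ascProd, mul_assoc, ← conjSeq_mul hsr x (by omega), ← mul_assoc, ← h1, mul_assoc]

end ConjSeq

/-! ### Matrices acting in selected copies of `V`. -/

section Embedding

variable {N m n p : ℕ} {A : Type*}

/-- The matrix `X` acting in the copies number `f 0, …, f (m - 1)` of `V`. -/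
def legs [Zero A] (f : Fin m → Fin n) (X : Matrix (Fin m → Fin N) (Fin m → Fin N) A) :
    Matrix (Fin n → Fin N) (Fin n → Fin N) A :=
  Matrix.of fun a b => if ∀ r, (∀ i, f i ≠ r) → a r = b r then X (a ∘ f) (b ∘ f) else 0

/-- A multi-index that is prescribed off the image of `f` is determined by its values on that image;
this is the matrix product of `legs_mul`. -/
theorem sum_agree_off [AddCommMonoid A] {f : Fin m → Fin n} (hf : f.Injective)
    (a : Fin n → Fin N) (F : (Fin m → Fin N) → A) :
    ∑ c : Fin n → Fin N, (if ∀ r, (∀ i, f i ≠ r) → a r = c r then F (c ∘ f) else 0) =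
      ∑ d, F d := by
  rw [← Finset.sum_filter]
  refine Finset.sum_bij' (fun c _ => c ∘ f) (fun d _ => Function.extend f d a) ?_ ?_ ?_ ?_ ?_
  · simp
  · intro d _
    simp only [Finset.mem_filter, Finset.mem_univ, true_and]
    intro r hr
    rw [Function.extend_apply' _ _ _ (by rintro ⟨i, hi⟩; exact hr i hi)]
  · intro c hc
    simp only [Finset.mem_filter, Finset.mem_univ, true_and] at hc
    funext r
    by_cases hr : ∃ i, f i = r
    · obtain ⟨i, rfl⟩ := hr
      rw [hf.extend_apply, Function.comp]
    · rw [Function.extend_apply' _ _ _ hr, hc r (by simpa using hr)]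
  · intro d _
    funext i
    exact hf.extend_apply _ _ _
  · simp

theorem legs_one [Zero A] [One A] (f : Fin m → Fin n) :
    legs f (1 : Matrix (Fin m → Fin N) (Fin m → Fin N) A) = 1 := by
  ext a b
  simp only [legs, Matrix.of_apply, Matrix.one_apply]
  rw [← ite_and]
  congr 1
  rw [eq_iff_iff]
  constructor
  · rintro ⟨h1, h2⟩
    funext r
    by_cases hr : ∃ i, f i = r
    · obtain ⟨i, rfl⟩ := hr
      exact congrFun h2 i
    · exact h1 r (by simpa using hr)
  · rintro rfl
    simp

theorem legs_mul [NonUnitalNonAssocSemiring A] {f : Fin m → Fin n} (hf : f.Injective)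
    (X Y : Matrix (Fin m → Fin N) (Fin m → Fin N) A) : legs f (X * Y) = legs f X * legs f Y := by
  ext a b
  simp only [legs, Matrix.of_apply, Matrix.mul_apply]
  by_cases hab : ∀ r, (∀ i, f i ≠ r) → a r = b r
  · rw [if_pos hab, ← sum_agree_off hf a]
    refine Finset.sum_congr rfl fun c _ => ?_
    by_cases hc : ∀ r, (∀ i, f i ≠ r) → a r = c r
    · rw [if_pos hc, if_pos hc, if_pos fun r hr => (hc r hr).symm.trans (hab r hr)]
    · rw [if_neg hc, if_neg hc, zero_mul]
  · rw [if_neg hab]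
    refine (Finset.sum_eq_zero fun c _ => ?_).symm
    by_cases hc : ∀ r, (∀ i, f i ≠ r) → a r = c r
    · rw [if_neg (c := ∀ r, (∀ i, f i ≠ r) → c r = b r)
        (fun h => hab fun r hr => (hc r hr).trans (h r hr)), mul_zero]
    · rw [if_neg hc, zero_mul]

theorem legs_comp [Zero A] {f : Fin n → Fin p} (hf : f.Injective) (g : Fin m → Fin n)
    (X : Matrix (Fin m → Fin N) (Fin m → Fin N) A) : legs f (legs g X) = legs (f ∘ g) X := by
  ext a b
  simp only [legs, Matrix.of_apply]
  rw [← ite_and]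
  congr 1
  rw [eq_iff_iff]
  constructor
  · rintro ⟨h1, h2⟩ r hr
    by_cases h : ∃ i, f i = r
    · obtain ⟨i, rfl⟩ := h
      exact h2 i fun j hj => hr j (by simp [hj])
    · exact h1 r (by simpa using h)
  · intro h
    exact ⟨fun r hr => h r fun i => hr _, fun i hi => h _ fun j hj => hi j (hf hj)⟩

theorem legs_map {A' : Type*} [Zero A] [Zero A'] (φ : A → A') (hφ : φ 0 = 0) (f : Fin m → Fin n)
    (X : Matrix (Fin m → Fin N) (Fin m → Fin N) A) : (legs f X).map φ = legs f (X.map φ) := by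
  ext a b
  simp only [legs, Matrix.of_apply, Matrix.map_apply, apply_ite φ, hφ]

/-- Matrices acting in disjoint sets of copies commute. -/
theorem legs_commute [NonUnitalNonAssocSemiring A] {f : Fin m → Fin n} {g : Fin p → Fin n}
    (hfg : ∀ i j, f i ≠ g j) (X : Matrix (Fin m → Fin N) (Fin m → Fin N) A)
    (Y : Matrix (Fin p → Fin N) (Fin p → Fin N) A) (hXY : ∀ a b c d, X a b * Y c d = Y c d * X a b) :
    legs f X * legs g Y = legs g Y * legs f X := by
  classical
  ext a b
  simp only [legs, Matrix.of_apply, Matrix.mul_apply]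
  -- In either product at most one intermediate multi-index contributes: it has already changed from
  -- `a` to `b` in the copies of the first factor and not yet in the others.
  have key : ∀ (c : Fin n → Fin N), ((∀ r, (∀ i, f i ≠ r) → a r = c r) ∧
      (∀ r, (∀ i, g i ≠ r) → c r = b r)) ↔ (c = fun r => if ∃ i, f i = r then b r else a r) ∧
      ∀ r, (∀ i, f i ≠ r) → (∀ i, g i ≠ r) → a r = b r := by
    intro c
    constructor
    · rintro ⟨h1, h2⟩
      refine ⟨?_, fun r hr hr' => (h1 r hr).trans (h2 r hr')⟩
      funext r
      split_ifs with hr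
      · obtain ⟨i, rfl⟩ := hr
        exact h2 _ fun j => (hfg i j).symm
      · exact (h1 r (by simpa using hr)).symm
    · rintro ⟨rfl, h⟩
      refine ⟨fun r hr => ?_, fun r hr => ?_⟩ <;> beta_reduce
      · rw [if_neg (by simpa using hr)]
      · split_ifs with h'
        · rfl
        · exact h r (by simpa using h') hr
  have key' : ∀ (c : Fin n → Fin N), ((∀ r, (∀ i, g i ≠ r) → a r = c r) ∧
      (∀ r, (∀ i, f i ≠ r) → c r = b r)) ↔ (c = fun r => if ∃ i, f i = r then a r else b r) ∧
      ∀ r, (∀ i, f i ≠ r) → (∀ i, g i ≠ r) → a r = b r := by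
    intro c
    constructor
    · rintro ⟨h1, h2⟩
      refine ⟨?_, fun r hr hr' => (h1 r hr').trans (h2 r hr)⟩
      funext r
      split_ifs with hr
      · obtain ⟨i, rfl⟩ := hr
        exact (h1 _ fun j => (hfg i j).symm).symm
      · exact h2 r (by simpa using hr)
    · rintro ⟨rfl, h⟩
      refine ⟨fun r hr => ?_, fun r hr => ?_⟩ <;> beta_reduce
      · split_ifs with h'
        · rfl
        · exact h r (by simpa using h') hr
      · rw [if_neg (by simpa using hr)]
  simp only [ite_zero_mul_ite_zero, key, key', ite_and, Finset.sum_ite_eq', Finset.mem_univ, if_true]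
  congr 1
  rw [← hXY]
  congr 2 <;> funext i <;> simp [hfg]

theorem addCopy_eq_legs [Zero A] (X : Matrix (Fin n → Fin N) (Fin n → Fin N) A) :
    addCopy X = legs Fin.castSucc X := by
  ext a b
  simp only [addCopy, legs, Matrix.of_apply]
  congr 1
  rw [eq_iff_iff]
  constructor
  · intro h r hr
    induction r using Fin.lastCases with
    | last => exact h
    | cast i => exact absurd rfl (hr i)
  · intro h
    exact h _ fun i => (Fin.castSucc_lt_last i).ne

theorem leg1_eq_legs [Zero A] (s : Fin n) (M : Matrix (Fin N) (Fin N) A) :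
    leg1 s M = legs ![s] (Matrix.of fun a b => M (a 0) (b 0)) := by
  ext a b
  simp only [leg1, legs, Matrix.of_apply]
  simp [eq_comm]

theorem leg2_eq_legs [Zero A] (s t : Fin n) (R : Matrix (Fin N × Fin N) (Fin N × Fin N) A) :
    leg2 s t R = legs ![s, t] (Matrix.of fun a b => R (a 0, a 1) (b 0, b 1)) := by
  ext a b
  simp only [leg2, legs, Matrix.of_apply]
  simp [Fin.forall_fin_two, eq_comm]

theorem legs_leg1 [Zero A] {f : Fin n → Fin p} (hf : f.Injective) (s : Fin n)
    (M : Matrix (Fin N) (Fin N) A) : legs f (leg1 s M) = leg1 (f s) M := by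
  rw [leg1_eq_legs, legs_comp hf, leg1_eq_legs]
  congr 1
  funext i; fin_cases i; rfl

theorem legs_leg2 [Zero A] {f : Fin n → Fin p} (hf : f.Injective) (s t : Fin n)
    (R : Matrix (Fin N × Fin N) (Fin N × Fin N) A) : legs f (leg2 s t R) = leg2 (f s) (f t) R := by
  rw [leg2_eq_legs, legs_comp hf, leg2_eq_legs]
  congr 1
  funext i; fin_cases i <;> rfl

theorem addCopy_leg1 [Zero A] (s : Fin n) (M : Matrix (Fin N) (Fin N) A) :
    addCopy (leg1 s M) = leg1 s.castSucc M := by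
  rw [addCopy_eq_legs, legs_leg1 (Fin.castSucc_injective n)]

theorem addCopy_leg2 [Zero A] (s t : Fin n) (R : Matrix (Fin N × Fin N) (Fin N × Fin N) A) :
    addCopy (leg2 s t R) = leg2 s.castSucc t.castSucc R := by
  rw [addCopy_eq_legs, legs_leg2 (Fin.castSucc_injective n)]

theorem leg2_commute_leg2 [NonUnitalNonAssocSemiring A] {s t s' t' : Fin n} (h1 : s ≠ s')
    (h2 : s ≠ t') (h3 : t ≠ s') (h4 : t ≠ t') (X Y : Matrix (Fin N × Fin N) (Fin N × Fin N) A)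
    (hXY : ∀ a b c d, X a b * Y c d = Y c d * X a b) :
    leg2 s t X * leg2 s' t' Y = leg2 s' t' Y * leg2 s t X := by
  rw [leg2_eq_legs, leg2_eq_legs]
  refine legs_commute ?_ _ _ fun a b c d => hXY _ _ _ _
  simp [Fin.forall_fin_two, *]

theorem leg2_commute_leg1 [NonUnitalNonAssocSemiring A] {s t s' : Fin n} (h1 : s ≠ s')
    (h3 : t ≠ s') (X : Matrix (Fin N × Fin N) (Fin N × Fin N) A) (Y : Matrix (Fin N) (Fin N) A)
    (hXY : ∀ a b c d, X a b * Y c d = Y c d * X a b) :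
    leg2 s t X * leg1 s' Y = leg1 s' Y * leg2 s t X := by
  rw [leg2_eq_legs, leg1_eq_legs]
  refine legs_commute ?_ _ _ fun a b c d => hXY _ _ _ _
  simp [Fin.forall_fin_two, *]

theorem pair_injective {s t : Fin n} (h : s ≠ t) : Function.Injective ![s, t] := by
  intro i j
  fin_cases i <;> fin_cases j <;> simp [h, h.symm]

theorem leg2_mul [NonUnitalNonAssocSemiring A] {s t : Fin n} (h : s ≠ t)
    (X Y : Matrix (Fin N × Fin N) (Fin N × Fin N) A) :
    leg2 s t (X * Y) = leg2 s t X * leg2 s t Y := by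
  simp only [leg2_eq_legs]
  rw [← legs_mul (pair_injective h)]
  congr 1
  ext a b
  simp only [Matrix.of_apply, Matrix.mul_apply]
  exact ((finTwoArrowEquiv (Fin N)).sum_comp
    fun c => X (a 0, a 1) c * Y c (b 0, b 1)).symm

theorem leg2_one [Zero A] [One A] (s t : Fin n) :
    leg2 s t (1 : Matrix (Fin N × Fin N) (Fin N × Fin N) A) = 1 := by
  rw [leg2_eq_legs, ← legs_one ![s, t]]
  congr 1
  ext a b
  simp only [Matrix.of_apply, Matrix.one_apply]
  congr 1
  simp [funext_iff, Fin.forall_fin_two]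

theorem leg2_add [AddZeroClass A] (s t : Fin n) (X Y : Matrix (Fin N × Fin N) (Fin N × Fin N) A) :
    leg2 s t (X + Y) = leg2 s t X + leg2 s t Y := by
  ext a b
  simp only [leg2, Matrix.of_apply, Matrix.add_apply]
  split_ifs <;> simp

theorem leg2_smul {K : Type*} [Zero A] [SMulZeroClass K A] (s t : Fin n) (c : K)
    (X : Matrix (Fin N × Fin N) (Fin N × Fin N) A) : leg2 s t (c • X) = c • leg2 s t X := by
  ext a b
  simp only [leg2, Matrix.of_apply, Matrix.smul_apply]
  split_ifs <;> simp

theorem legs_add [AddZeroClass A] (f : Fin m → Fin n)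
    (X Y : Matrix (Fin m → Fin N) (Fin m → Fin N) A) :
    legs f (X + Y) = legs f X + legs f Y := by
  ext a b
  simp only [legs, Matrix.of_apply, Matrix.add_apply]
  split_ifs <;> simp

theorem legs_smul {K : Type*} [Zero A] [SMulZeroClass K A] (f : Fin m → Fin n) (c : K)
    (X : Matrix (Fin m → Fin N) (Fin m → Fin N) A) : legs f (c • X) = c • legs f X := by
  ext a b
  simp only [legs, Matrix.of_apply, Matrix.smul_apply]
  split_ifs <;> simp

/-- The embedding `legs f` as a homomorphism of algebras. -/
def legsHom (K : Type*) [Field K] [Ring A] [Algebra K A] {f : Fin m → Fin n} (hf : f.Injective) :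
    Matrix (Fin m → Fin N) (Fin m → Fin N) A →ₐ[K] Matrix (Fin n → Fin N) (Fin n → Fin N) A :=
  AlgHom.ofLinearMap
    { toFun := legs f
      map_add' := legs_add f
      map_smul' := fun c X => legs_smul f c X } (legs_one f) (legs_mul hf)

/-- `X ↦ X ⊗ I` as a homomorphism of algebras. -/
def addCopyHom (K : Type*) [Field K] [Ring A] [Algebra K A] :
    Matrix (Fin n → Fin N) (Fin n → Fin N) A →ₐ[K]
      Matrix (Fin (n + 1) → Fin N) (Fin (n + 1) → Fin N) A :=
  legsHom K (Fin.castSucc_injective n)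

theorem addCopyHom_apply (K : Type*) [Field K] [Ring A] [Algebra K A]
    (X : Matrix (Fin n → Fin N) (Fin n → Fin N) A) : addCopyHom K X = addCopy X :=
  (addCopy_eq_legs X).symm

end Embedding

/-! ### Extension of scalars for numerical matrices. -/

section CoeMat

variable {K : Type*} [Field K] {A : Type*} [Ring A] [Algebra K A] {ι : Type*} [Fintype ι]
  [DecidableEq ι]

/-- `coeMat` as a homomorphism of algebras. -/
def coeMatHom (K A ι : Type*) [Field K] [Ring A] [Algebra K A] [Fintype ι] [DecidableEq ι] :
    Matrix ι ι K →ₐ[K] Matrix ι ι A :=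
  (Algebra.ofId K A).mapMatrix

theorem coeMatHom_apply (M : Matrix ι ι K) : coeMatHom K A ι M = coeMat M := rfl

theorem coeMat_legs {N m n : ℕ} (f : Fin m → Fin n) (X : Matrix (Fin m → Fin N) (Fin m → Fin N) K) :
    (coeMat (legs f X) : Matrix _ _ A) = legs f (coeMat X) :=
  legs_map _ (map_zero _) f X

theorem coeMat_leg2 {N n : ℕ} (s t : Fin n) (X : Matrix (Fin N × Fin N) (Fin N × Fin N) K) :
    (coeMat (leg2 s t X) : Matrix _ _ A) = leg2 s t (coeMat X) := by
  rw [leg2_eq_legs, coeMat_legs, leg2_eq_legs]; rfl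

theorem coeMat_addCopy {N n : ℕ} (X : Matrix (Fin n → Fin N) (Fin n → Fin N) K) :
    (coeMat (addCopy X) : Matrix _ _ A) = addCopy (coeMat X) := by
  rw [addCopy_eq_legs, coeMat_legs, addCopy_eq_legs]

end CoeMat

/-! ### The skew inverse and the matrix `C`. -/

section SkewInverse

variable {K : Type*} [Field K] {N : ℕ} {R Ψ S : Matrix (Fin N × Fin N) (Fin N × Fin N) K}

theorem sum_fin_three {α M : Type*} [Fintype α] [AddCommMonoid M] (F : (Fin 3 → α) → M) :
    ∑ c, F c = ∑ p, ∑ r, ∑ s, F ![p, r, s] := by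
  let e : (Fin 3 → α) ≃ α × α × α :=
    { toFun := fun f => (f 0, f 1, f 2)
      invFun := fun p => ![p.1, p.2.1, p.2.2]
      left_inv := fun f => by funext i; fin_cases i <;> rfl
      right_inv := fun p => rfl }
  rw [← e.symm.sum_comp, Fintype.sum_prod_type]
  refine Finset.sum_congr rfl fun p _ => ?_
  rw [Fintype.sum_prod_type]
  rfl

theorem leg2_zero_one_apply (X : Matrix (Fin N × Fin N) (Fin N × Fin N) K)
    (a b c p r s : Fin N) : leg2 (n := 3) 0 1 X ![a, b, c] ![p, r, s] =
      if s = c then X (a, b) (p, r) else 0 :=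
  if_congr (by simp [Fin.forall_fin_succ, eq_comm]) rfl rfl

theorem leg2_one_two_apply (X : Matrix (Fin N × Fin N) (Fin N × Fin N) K)
    (a b c p r s : Fin N) : leg2 (n := 3) 1 2 X ![a, b, c] ![p, r, s] =
      if p = a then X (b, c) (r, s) else 0 :=
  if_congr (by simp [Fin.forall_fin_succ, eq_comm]) rfl rfl

theorem leg2_zero_one_mul (X : Matrix (Fin N × Fin N) (Fin N × Fin N) K)
    (M : Matrix (Fin 3 → Fin N) (Fin 3 → Fin N) K) (a b c : Fin N) (w : Fin 3 → Fin N) :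
    ((leg2 0 1 X : Matrix (Fin 3 → Fin N) _ K) * M) ![a, b, c] w =
      ∑ p, ∑ r, X (a, b) (p, r) * M ![p, r, c] w := by
  simp only [Matrix.mul_apply, sum_fin_three, leg2_zero_one_apply, ite_mul, zero_mul,
    Finset.sum_ite_eq', Finset.mem_univ, if_true]

theorem leg2_one_two_mul (X : Matrix (Fin N × Fin N) (Fin N × Fin N) K)
    (M : Matrix (Fin 3 → Fin N) (Fin 3 → Fin N) K) (a b c : Fin N) (w : Fin 3 → Fin N) :
    ((leg2 1 2 X : Matrix (Fin 3 → Fin N) _ K) * M) ![a, b, c] w =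
      ∑ p, ∑ r, X (b, c) (p, r) * M ![a, p, r] w := by
  simp only [Matrix.mul_apply, sum_fin_three, leg2_one_two_apply, ite_mul, zero_mul]
  rw [Finset.sum_eq_single a (fun p _ hp => by simp [hp]) (by simp)]
  simp

theorem braid_left_apply (X Y Z : Matrix (Fin N × Fin N) (Fin N × Fin N) K)
    (a b c x y z : Fin N) :
    (leg2 0 1 X * leg2 1 2 Y * leg2 0 1 Z : Matrix (Fin 3 → Fin N) (Fin 3 → Fin N) K)
      ![a, b, c] ![x, y, z] =
      ∑ p, ∑ r, ∑ s, X (a, b) (p, r) * Y (r, c) (s, z) * Z (p, s) (x, y) := by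
  simp only [mul_assoc, leg2_zero_one_mul, leg2_one_two_mul, leg2_zero_one_apply, mul_ite,
    mul_zero, Finset.mul_sum]
  simp

theorem braid_right_apply (X Y Z : Matrix (Fin N × Fin N) (Fin N × Fin N) K)
    (a b c x y z : Fin N) :
    (leg2 1 2 X * leg2 0 1 Y * leg2 1 2 Z : Matrix (Fin 3 → Fin N) (Fin 3 → Fin N) K)
      ![a, b, c] ![x, y, z] =
      ∑ p, ∑ r, ∑ s, X (b, c) (p, r) * Y (a, p) (x, s) * Z (s, r) (y, z) := by
  simp only [mul_assoc, leg2_zero_one_mul, leg2_one_two_mul, leg2_one_two_apply, mul_ite,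
    mul_zero, Finset.mul_sum]
  refine Finset.sum_congr rfl fun p _ => Finset.sum_congr rfl fun r _ => ?_
  rw [Finset.sum_comm]
  simp

/-- `R_{ij}^{kl}` as a matrix with rows `(i, k)` and columns `(j, l)`. -/
def skewMat (R : Matrix (Fin N × Fin N) (Fin N × Fin N) K) :
    Matrix (Fin N × Fin N) (Fin N × Fin N) K :=
  Matrix.of fun a b => R (a.1, b.1) (a.2, b.2)

/-- `Ψ_{lp}^{jr}` as a matrix with rows `(j, l)` and columns `(r, p)`. -/
def skewMatInv (Ψ : Matrix (Fin N × Fin N) (Fin N × Fin N) K) :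
    Matrix (Fin N × Fin N) (Fin N × Fin N) K :=
  Matrix.of fun a b => Ψ (a.2, b.2) (a.1, b.1)

/-- After regrouping the indices, skew-invertibility is ordinary one-sided inversion of a square
matrix, hence two-sided. -/
theorem IsSkewInverse.skewMat_mul (h : IsSkewInverse R Ψ) : skewMat R * skewMatInv Ψ = 1 := by
  ext ⟨i, k⟩ ⟨r, p⟩
  rw [Matrix.mul_apply, Fintype.sum_prod_type]
  refine (h i k p r).trans ?_
  simp [Matrix.one_apply, eq_comm]

theorem IsSkewInverse.skewMatInv_mul (h : IsSkewInverse R Ψ) : skewMatInv Ψ * skewMat R = 1 :=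
  mul_eq_one_comm.mp h.skewMat_mul

theorem sum_skewMatInv (c z : Fin N) : ∑ u, skewMatInv Ψ (c, z) (u, u) = matC Ψ z c := rfl

/-- The `R`-trace of `R₁ X₁ R₁⁻¹` in the second copy, in components. -/
theorem IsSkewInverse.sum_matC_of_braid (h : IsSkewInverse R Ψ)
    {A B : Matrix (Fin N × Fin N) (Fin N × Fin N) K} (hAB : A * B = 1)
    (hbr : leg2 (n := 3) 0 1 A * leg2 1 2 R * leg2 0 1 B =
      leg2 1 2 B * leg2 0 1 R * leg2 1 2 A) (b j l y : Fin N) :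
    ∑ c, ∑ r, ∑ z, B (b, c) (j, r) * A (l, r) (y, z) * matC Ψ z c =
      if b = y then matC Ψ l j else 0 := by
  let U : Matrix (Fin N × Fin N) (Fin N × Fin N) K :=
    Matrix.of fun a w => ∑ p, A (a.1, b) (p, w.1) * B (p, w.2) (a.2, y)
  let V : Matrix (Fin N × Fin N) (Fin N × Fin N) K :=
    Matrix.of fun w c => ∑ r, B (b, c.1) (w.1, r) * A (w.2, r) (y, c.2)
  -- For fixed `b` and `y`, this is the mixed braid relation read with the regrouped indices.
  have hUV : U * skewMat R = skewMat R * V := by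
    ext ⟨a, x⟩ ⟨c, z⟩
    have := congrFun (congrFun hbr ![a, b, c]) ![x, y, z]
    rw [braid_left_apply, braid_right_apply] at this
    simp only [Matrix.mul_apply, Fintype.sum_prod_type, U, V, skewMat, Matrix.of_apply,
      Finset.sum_mul, Finset.mul_sum]
    calc _ = ∑ p, ∑ r, ∑ s, A (a, b) (p, r) * R (r, c) (s, z) * B (p, s) (x, y) := by
          rw [Finset.sum_comm_cycle]
          refine Finset.sum_congr rfl fun p _ => Finset.sum_congr rfl fun r _ =>
            Finset.sum_congr rfl fun s _ => ?_
          ring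
      _ = _ := by
          rw [this]
          refine Finset.sum_congr rfl fun p _ => ?_
          rw [Finset.sum_comm]
          refine Finset.sum_congr rfl fun r _ => Finset.sum_congr rfl fun s _ => ?_
          ring
  have hVU : V * skewMatInv Ψ = skewMatInv Ψ * U := by
    calc V * skewMatInv Ψ = skewMatInv Ψ * (skewMat R * V) * skewMatInv Ψ := by
          rw [← mul_assoc (skewMatInv Ψ), h.skewMatInv_mul, one_mul]
      _ = skewMatInv Ψ * U := by
          rw [← hUV, mul_assoc, mul_assoc, h.skewMat_mul, mul_one]
  -- Contracting the last index pair turns `Ψ` into `C` on the left, and `U` into Kronecker deltas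
  -- on the right because `A * B = 1`.
  have key : ∑ u, (V * skewMatInv Ψ) (j, l) (u, u) = ∑ u, (skewMatInv Ψ * U) (j, l) (u, u) := by
    rw [hVU]
  have hU : ∀ a x, ∑ u, U (a, x) (u, u) = if a = x ∧ b = y then 1 else 0 := by
    intro a x
    have := congrFun (congrFun hAB (a, b)) (x, y)
    rw [Matrix.mul_apply, Fintype.sum_prod_type, Finset.sum_comm, Matrix.one_apply] at this
    simpa [U] using this
  have hsum : ∀ X Y : Matrix (Fin N × Fin N) (Fin N × Fin N) K, ∑ u, (X * Y) (j, l) (u, u) =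
      ∑ c, ∑ z, X (j, l) (c, z) * ∑ u, Y (c, z) (u, u) := by
    intro X Y
    simp only [Matrix.mul_apply, Fintype.sum_prod_type, Finset.mul_sum]
    rw [Finset.sum_comm]
    exact Finset.sum_congr rfl fun c _ => Finset.sum_comm
  rw [hsum, hsum] at key
  simp only [sum_skewMatInv, hU] at key
  calc _ = ∑ c, ∑ z, V (j, l) (c, z) * matC Ψ z c := by
        refine Finset.sum_congr rfl fun c _ => ?_
        rw [Finset.sum_comm]
        simp only [V, Matrix.of_apply, Finset.sum_mul]
    _ = _ := by
        rw [key]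
        split_ifs with hby
        · simp [hby, ← sum_skewMatInv]
        · simp [hby]

variable {q : K}

theorem IsHeckeSymmetry.sq (hR : IsHeckeSymmetry q R) (hq : q ≠ 0) :
    R * R = 1 + (q - q⁻¹) • R := by
  have h := hR.hecke
  simp only [mul_add, sub_mul, smul_mul_assoc, mul_smul_comm, one_mul, mul_one, smul_sub, smul_smul,
    inv_mul_cancel₀ hq, one_smul] at h
  rw [sub_smul, ← sub_eq_zero, ← neg_eq_zero, ← h]
  abel

theorem IsHeckeSymmetry.mul_inv (hR : IsHeckeSymmetry q R) (hq : q ≠ 0) : R * R⁻¹ = 1 := by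
  refine Matrix.mul_nonsing_inv _ (Matrix.isUnit_det_of_right_inverse
    (B := R - (q - q⁻¹) • 1) ?_)
  rw [mul_sub, hR.sq hq]; simp

theorem IsHeckeSymmetry.inv_mul (hR : IsHeckeSymmetry q R) (hq : q ≠ 0) : R⁻¹ * R = 1 :=
  mul_eq_one_comm.mp (hR.mul_inv hq)

/-- Together with `IsHeckeSymmetry.braid_inv_right`, this is the mixed braid relation that
`IsSkewInverse.sum_matC_of_braid` takes as input. -/
theorem IsHeckeSymmetry.braid_inv_left (hR : IsHeckeSymmetry q R) (hq : q ≠ 0) :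
    leg2 (n := 3) 0 1 R⁻¹ * leg2 1 2 R * leg2 0 1 R = leg2 1 2 R * leg2 0 1 R * leg2 1 2 R⁻¹ := by
  have h := hR.braiding
  unfold IsBraiding at h
  have h1 : leg2 (n := 3) 0 1 R⁻¹ * leg2 0 1 R = 1 := by
    rw [← leg2_mul (by decide), hR.inv_mul hq, leg2_one]
  have h2 : leg2 (n := 3) 1 2 R * leg2 1 2 R⁻¹ = 1 := by
    rw [← leg2_mul (by decide), hR.mul_inv hq, leg2_one]
  calc _ = leg2 0 1 R⁻¹ * (leg2 1 2 R * leg2 0 1 R * leg2 1 2 R) * leg2 1 2 R⁻¹ := by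
        simp only [mul_assoc, h2, mul_one]
    _ = leg2 0 1 R⁻¹ * leg2 0 1 R * (leg2 1 2 R * leg2 0 1 R * leg2 1 2 R⁻¹) := by
        rw [← h]; simp only [mul_assoc]
    _ = _ := by rw [h1, one_mul]

theorem IsHeckeSymmetry.braid_inv_right (hR : IsHeckeSymmetry q R) (hq : q ≠ 0) :
    leg2 (n := 3) 0 1 R * leg2 1 2 R * leg2 0 1 R⁻¹ = leg2 1 2 R⁻¹ * leg2 0 1 R * leg2 1 2 R := by
  have h := hR.braiding
  unfold IsBraiding at h
  have h1 : leg2 (n := 3) 0 1 R * leg2 0 1 R⁻¹ = 1 := by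
    rw [← leg2_mul (by decide), hR.mul_inv hq, leg2_one]
  have h2 : leg2 (n := 3) 1 2 R⁻¹ * leg2 1 2 R = 1 := by
    rw [← leg2_mul (by decide), hR.inv_mul hq, leg2_one]
  calc _ = leg2 1 2 R⁻¹ * (leg2 1 2 R * leg2 0 1 R * leg2 1 2 R) * leg2 0 1 R⁻¹ := by
        simp only [← mul_assoc, h2, one_mul]
    _ = leg2 1 2 R⁻¹ * leg2 0 1 R * leg2 1 2 R * (leg2 0 1 R * leg2 0 1 R⁻¹) := by
        rw [← h]; simp only [mul_assoc]
    _ = _ := by rw [h1, mul_one]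

/-- This is `Tr_{R(2)} R = I`, the contraction of the defining relation of `Ψ`. -/
theorem IsSkewInverse.sum_matC_mul (h : IsSkewInverse R Ψ) (a b : Fin N) :
    ∑ i, ∑ j, matC Ψ i j * R (a, j) (b, i) = if a = b then 1 else 0 := by
  calc _ = ∑ k, ∑ j, ∑ i, R (a, j) (b, i) * Ψ (i, k) (j, k) := by
        simp only [matC, Matrix.of_apply, Finset.sum_mul, mul_comm (Ψ _ _)]
        rw [Finset.sum_comm_cycle]
        exact Finset.sum_congr rfl fun k _ => Finset.sum_comm
    _ = ∑ k, if a = k ∧ k = b then 1 else 0 := Finset.sum_congr rfl fun k _ => h a b k k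
    _ = _ := by simp [ite_and]

/-- `C₁ C₂ R = R C₁ C₂`. -/
theorem IsSkewInverse.kronecker_matC_comm (h : IsSkewInverse R Ψ) (hR : IsHeckeSymmetry q R)
    (hq : q ≠ 0) : R * Matrix.kronecker (matC Ψ) (matC Ψ) =
      Matrix.kronecker (matC Ψ) (matC Ψ) * R := by
  set C := matC Ψ with hC
  -- `G` and `G'` are `R⁻¹` contracted with a single `C` from one side or the other. The trace
  -- identity for `R` and for `R⁻¹` computes `skewMat R * G` and `skewMat R * G'`, and so expresses
  -- both through `Ψ` and `C`.
  let G : Matrix (Fin N × Fin N) (Fin N × Fin N) K :=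
    Matrix.of fun a b => ∑ i, R⁻¹ (b.2, a.2) (b.1, i) * C i a.1
  let G' : Matrix (Fin N × Fin N) (Fin N × Fin N) K :=
    Matrix.of fun a b => ∑ j, C a.2 j * R⁻¹ (b.1, j) (b.2, a.1)
  have hG : G = skewMatInv Ψ * Matrix.of (fun a b => if a.1 = b.1 then C b.2 a.2 else 0) := by
    rw [← one_mul G, ← h.skewMatInv_mul, mul_assoc]
    congr 1
    ext ⟨a, c⟩ ⟨b, e⟩
    have := h.sum_matC_of_braid (hR.inv_mul hq) (hR.braid_inv_left hq) a c e b
    simp only [Matrix.mul_apply, Fintype.sum_prod_type, G, skewMat, Matrix.of_apply,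
      Finset.mul_sum, ← mul_assoc]
    exact this
  have hG' : G' = skewMatInv Ψ * Matrix.of (fun a b => if a.2 = b.1 then C a.1 b.2 else 0) := by
    rw [← one_mul G', ← h.skewMatInv_mul, mul_assoc]
    congr 1
    ext ⟨e, b⟩ ⟨a, c⟩
    have := h.sum_matC_of_braid (hR.mul_inv hq) (hR.braid_inv_right hq) a c e b
    simp only [Matrix.mul_apply, Fintype.sum_prod_type, G', skewMat, Matrix.of_apply,
      Finset.mul_sum, ← mul_assoc]
    simp only [eq_comm (a := b)]
    rw [← this, Finset.sum_comm_cycle]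
    refine Finset.sum_congr rfl fun j _ => Finset.sum_congr rfl fun d _ =>
      Finset.sum_congr rfl fun i _ => ?_
    ring
  -- Contracting with the second `C`, both sides become the same tensor: `Ψ` with one `C` attached
  -- on each side.
  have key : R⁻¹ * Matrix.kronecker C C = Matrix.kronecker C C * R⁻¹ := by
    ext ⟨e, d⟩ ⟨c, j⟩
    have h1 : (R⁻¹ * Matrix.kronecker C C) (e, d) (c, j) = ∑ b, G (j, d) (b, e) * C b c := by
      simp only [Matrix.mul_apply, Fintype.sum_prod_type, G, Matrix.of_apply, Matrix.kronecker,
        Matrix.kroneckerMap_apply, Finset.sum_mul]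
      refine Finset.sum_congr rfl fun b _ => Finset.sum_congr rfl fun i _ => ?_
      ring
    have h2 : (Matrix.kronecker C C * R⁻¹) (e, d) (c, j) = ∑ x, C e x * G' (j, d) (x, c) := by
      simp only [Matrix.mul_apply, Fintype.sum_prod_type, G', Matrix.of_apply, Matrix.kronecker,
        Matrix.kroneckerMap_apply, Finset.mul_sum]
      refine Finset.sum_congr rfl fun b _ => Finset.sum_congr rfl fun i _ => ?_
      ring
    rw [h1, h2, hG, hG']
    simp only [Matrix.mul_apply, Fintype.sum_prod_type, Matrix.of_apply, skewMatInv]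
    simp [Finset.sum_mul, Finset.mul_sum]
    rw [Finset.sum_comm]
    refine Finset.sum_congr rfl fun x _ => Finset.sum_congr rfl fun y _ => ?_
    ring
  calc _ = R * (Matrix.kronecker C C * R⁻¹) * R := by
        rw [mul_assoc, mul_assoc, hR.inv_mul hq, mul_one]
    _ = _ := by rw [← key, ← mul_assoc R, hR.mul_inv hq, one_mul]

end SkewInverse

/-! ### The `R`-trace in the last copy. -/

section PartialTrace

variable {K : Type*} [Field K] {N n : ℕ} {A : Type*} [Ring A] [Algebra K A]

/-- Two more copies of `V`. -/
def snoc₂ (a : Fin n → Fin N) (x : Fin N × Fin N) : Fin (n + 2) → Fin N :=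
  Fin.snoc (α := fun _ => Fin N) (Fin.snoc (α := fun _ => Fin N) a x.1) x.2

theorem sum_snoc {M : Type*} [AddCommMonoid M] (F : (Fin (n + 1) → Fin N) → M) :
    ∑ c, F c = ∑ a : Fin n → Fin N, ∑ i, F (Fin.snoc a i) := by
  rw [← (Fin.snocEquiv fun _ => Fin N).sum_comp, Fintype.sum_prod_type, Finset.sum_comm]
  rfl

theorem sum_snoc₂ {M : Type*} [AddCommMonoid M] (F : (Fin (n + 2) → Fin N) → M) :
    ∑ c, F c = ∑ a : Fin n → Fin N, ∑ x, F (snoc₂ a x) := by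
  rw [sum_snoc, sum_snoc]
  simp only [Fintype.sum_prod_type]
  rfl

theorem exists_snoc (c : Fin (n + 1) → Fin N) :
    ∃ (a : Fin n → Fin N) (i : Fin N), c = Fin.snoc a i :=
  ⟨Fin.init c, c (Fin.last n), (Fin.snoc_init_self c).symm⟩

theorem addCopy_snoc {A : Type*} [Zero A] (X : Matrix (Fin n → Fin N) (Fin n → Fin N) A)
    (a b : Fin n → Fin N) (i j : Fin N) :
    addCopy X (Fin.snoc a i) (Fin.snoc b j) = if i = j then X a b else 0 :=
  if_congr (by simp) (by simp) rfl

theorem leg2_last_snoc₂ {A : Type*} [Zero A] (R : Matrix (Fin N × Fin N) (Fin N × Fin N) A)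
    (a b : Fin n → Fin N) (x y : Fin N × Fin N) :
    leg2 (Fin.last n).castSucc (Fin.last (n + 1)) R (snoc₂ a x) (snoc₂ b y) =
      if a = b then R x y else 0 := by
  refine if_congr ?_ ?_ rfl
  · constructor
    · intro h
      funext i
      have := h i.castSucc.castSucc (by simp [Fin.ext_iff]; omega) (by simp [Fin.ext_iff]; omega)
      simpa [snoc₂] using this
    · rintro rfl r h1 h2
      induction r using Fin.lastCases with
      | last => exact absurd rfl h2
      | cast r =>
        induction r using Fin.lastCases with
        | last => exact absurd rfl h1
        | cast r => simp [snoc₂]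
  · simp [snoc₂]

theorem coeMat_mul_apply {ι : Type*} [Fintype ι] (X : Matrix ι ι K) (M : Matrix ι ι A) (a b : ι) :
    (coeMat X * M : Matrix ι ι A) a b = ∑ c, X a c • M c b := by
  simp [Matrix.mul_apply, coeMat, Algebra.smul_def]

theorem mul_coeMat_apply {ι : Type*} [Fintype ι] (X : Matrix ι ι K) (M : Matrix ι ι A) (a b : ι) :
    (M * coeMat X : Matrix ι ι A) a b = ∑ c, X c b • M a c := by
  simp only [Matrix.mul_apply, coeMat, Matrix.map_apply, Algebra.smul_def]
  exact Finset.sum_congr rfl fun c _ => (Algebra.commutes _ _).symm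

theorem coeMat_leg2_last_mul (R : Matrix (Fin N × Fin N) (Fin N × Fin N) K)
    (M : Matrix (Fin (n + 2) → Fin N) (Fin (n + 2) → Fin N) A) (a : Fin n → Fin N)
    (x : Fin N × Fin N) (w : Fin (n + 2) → Fin N) :
    (coeMat (leg2 (Fin.last n).castSucc (Fin.last (n + 1)) R) * M :
      Matrix (Fin (n + 2) → Fin N) (Fin (n + 2) → Fin N) A) (snoc₂ a x) w =
      ∑ y, R x y • M (snoc₂ a y) w := by
  rw [coeMat_mul_apply, sum_snoc₂]
  simp only [leg2_last_snoc₂, ite_smul, zero_smul]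
  rw [Finset.sum_comm]
  simp

theorem mul_coeMat_leg2_last (R : Matrix (Fin N × Fin N) (Fin N × Fin N) K)
    (M : Matrix (Fin (n + 2) → Fin N) (Fin (n + 2) → Fin N) A) (b : Fin n → Fin N)
    (x : Fin N × Fin N) (w : Fin (n + 2) → Fin N) :
    (M * coeMat (leg2 (Fin.last n).castSucc (Fin.last (n + 1)) R) :
      Matrix (Fin (n + 2) → Fin N) (Fin (n + 2) → Fin N) A) w (snoc₂ b x) =
      ∑ y, R y x • M w (snoc₂ b y) := by
  rw [mul_coeMat_apply, sum_snoc₂]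
  simp only [leg2_last_snoc₂, ite_smul, zero_smul]
  rw [Finset.sum_comm]
  simp

variable (C : Matrix (Fin N) (Fin N) K)

theorem rTraceLast_addCopy_mul (X : Matrix (Fin n → Fin N) (Fin n → Fin N) A⟦X⟧)
    (M : Matrix (Fin (n + 1) → Fin N) (Fin (n + 1) → Fin N) A⟦X⟧) :
    rTraceLast C (addCopy X * M) = X * rTraceLast C M := by
  ext1 a b
  simp only [rTraceLast, Matrix.of_apply, Matrix.mul_apply, sum_snoc, addCopy_snoc, ite_mul,
    zero_mul, Finset.sum_ite_eq, Finset.mem_univ, if_true, Finset.smul_sum, Finset.mul_sum,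
    mul_smul_comm]
  rw [Finset.sum_comm_cycle]

theorem rTraceLast_mul_addCopy (X : Matrix (Fin n → Fin N) (Fin n → Fin N) A⟦X⟧)
    (M : Matrix (Fin (n + 1) → Fin N) (Fin (n + 1) → Fin N) A⟦X⟧) :
    rTraceLast C (M * addCopy X) = rTraceLast C M * X := by
  ext1 a b
  simp only [rTraceLast, Matrix.of_apply, Matrix.mul_apply, sum_snoc, addCopy_snoc, mul_ite,
    mul_zero, Finset.sum_ite_eq', Finset.mem_univ, if_true, Finset.smul_sum, Finset.sum_mul,
    smul_mul_assoc]
  rw [Finset.sum_comm_cycle]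

theorem rTraceLast_add (M M' : Matrix (Fin (n + 1) → Fin N) (Fin (n + 1) → Fin N) A⟦X⟧) :
    rTraceLast C (M + M') = rTraceLast C M + rTraceLast C M' := by
  ext1 a b
  simp [rTraceLast, Finset.sum_add_distrib]

theorem rTraceLast_smul (c : K) (M : Matrix (Fin (n + 1) → Fin N) (Fin (n + 1) → Fin N) A⟦X⟧) :
    rTraceLast C (c • M) = c • rTraceLast C M := by
  ext1 a b
  simp [rTraceLast, Finset.smul_sum, smul_comm c]

theorem rTraceLast_snoc (M : Matrix (Fin (n + 2) → Fin N) (Fin (n + 2) → Fin N) A⟦X⟧)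
    (a b : Fin n → Fin N) (x y : Fin N) :
    rTraceLast C M (Fin.snoc a x) (Fin.snoc b y) =
      ∑ i, ∑ j, C i j • M (snoc₂ a (x, j)) (snoc₂ b (y, i)) := rfl

theorem rTraceLast_rTraceLast_apply
    (M : Matrix (Fin (n + 2) → Fin N) (Fin (n + 2) → Fin N) A⟦X⟧) (a b : Fin n → Fin N) :
    rTraceLast C (rTraceLast C M) a b =
      ∑ x, ∑ y, Matrix.kronecker C C x y • M (snoc₂ a y) (snoc₂ b x) := by
  simp only [rTraceLast, Matrix.of_apply, Fintype.sum_prod_type, Finset.smul_sum, smul_smul]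
  refine Finset.sum_congr rfl fun i _ => ?_
  rw [Finset.sum_comm]
  rfl

/-- The entries of `R` are scalars, so cyclicity only requires moving `R` past the weight `C ⊗ C` of
the double trace. -/
theorem rTraceLast_rTraceLast_comm {C : Matrix (Fin N) (Fin N) K}
    {R : Matrix (Fin N × Fin N) (Fin N × Fin N) K}
    (hC : R * Matrix.kronecker C C = Matrix.kronecker C C * R)
    (M : Matrix (Fin (n + 2) → Fin N) (Fin (n + 2) → Fin N) A⟦X⟧) :
    rTraceLast C (rTraceLast C
        (M * coeMat (leg2 (Fin.last n).castSucc (Fin.last (n + 1)) R))) =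
      rTraceLast C (rTraceLast C
        (coeMat (leg2 (Fin.last n).castSucc (Fin.last (n + 1)) R) * M)) := by
  ext1 a b
  simp only [rTraceLast_rTraceLast_apply, mul_coeMat_leg2_last, coeMat_leg2_last_mul,
    Finset.smul_sum, smul_smul]
  have h : ∀ z y, ∑ x, R z x * Matrix.kronecker C C x y =
      ∑ x, Matrix.kronecker C C z x * R x y := fun z y => by
    simpa only [Matrix.mul_apply] using congrFun (congrFun hC z) y
  calc _ = ∑ z, ∑ y, (∑ x, R z x * Matrix.kronecker C C x y) • M (snoc₂ a y) (snoc₂ b z) := by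
        simp only [Finset.sum_smul]
        rw [Finset.sum_comm_cycle]
        refine Finset.sum_congr rfl fun z _ => ?_
        rw [Finset.sum_comm]
        simp only [mul_comm]
    _ = _ := by
        simp only [h, Finset.sum_smul]
        refine Finset.sum_congr rfl fun z _ => ?_
        rw [Finset.sum_comm]

theorem IsSkewInverse.rTraceLast_leg2 {R Ψ : Matrix (Fin N × Fin N) (Fin N × Fin N) K}
    (h : IsSkewInverse R Ψ) :
    rTraceLast (n := n + 1) (matC Ψ)
      (coeMat (leg2 (Fin.last n).castSucc (Fin.last (n + 1)) R) :
        Matrix (Fin (n + 2) → Fin N) (Fin (n + 2) → Fin N) A⟦X⟧) = 1 := by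
  ext1 a b
  obtain ⟨a, x, rfl⟩ := exists_snoc a
  obtain ⟨b, y, rfl⟩ := exists_snoc b
  have key : ∀ i j, (coeMat (leg2 (Fin.last n).castSucc (Fin.last (n + 1)) R) :
        Matrix (Fin (n + 2) → Fin N) (Fin (n + 2) → Fin N) A⟦X⟧) (snoc₂ a (x, j)) (snoc₂ b (y, i))
      = if a = b then algebraMap K A⟦X⟧ (R (x, j) (y, i)) else 0 := fun i j => by
    rw [coeMat, Matrix.map_apply, leg2_last_snoc₂, apply_ite (algebraMap K A⟦X⟧), map_zero]
  rw [rTraceLast_snoc, Matrix.one_apply]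
  simp only [key]
  have h1 := h.sum_matC_mul x y
  have h2 : (Fin.snoc a x : Fin (n + 1) → Fin N) = Fin.snoc b y ↔ a = b ∧ x = y := by
    simp [Fin.snoc_inj]
  split_ifs with hab hs hs
  · rw [if_pos (h2.mp hs).2] at h1
    simp only [Algebra.smul_def, ← map_mul, ← map_sum, h1, map_one]
  · rw [if_neg fun hxy => hs (h2.mpr ⟨hab, hxy⟩)] at h1
    simp only [Algebra.smul_def, ← map_mul, ← map_sum, h1, map_zero]
  · exact absurd (h2.mp hs).1 hab
  · simp

/-- The coefficient of each entry of `Y` is the sum evaluated by `IsSkewInverse.sum_matC_of_braid`.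
-/
theorem IsSkewInverse.rTraceLast_conj {q : K} {R Ψ : Matrix (Fin N × Fin N) (Fin N × Fin N) K}
    (h : IsSkewInverse R Ψ) (hR : IsHeckeSymmetry q R) (hq : q ≠ 0)
    (Y : Matrix (Fin (n + 1) → Fin N) (Fin (n + 1) → Fin N) A⟦X⟧) :
    rTraceLast (matC Ψ) (coeMat (leg2 (Fin.last n).castSucc (Fin.last (n + 1)) R) * addCopy Y *
      coeMat (leg2 (Fin.last n).castSucc (Fin.last (n + 1)) R⁻¹)) =
      addCopy (rTraceLast (matC Ψ) Y) := by
  ext1 a b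
  obtain ⟨a, x, rfl⟩ := exists_snoc a
  obtain ⟨b, y, rfl⟩ := exists_snoc b
  have h1 := fun j l => h.sum_matC_of_braid (hR.inv_mul hq) (hR.braid_inv_left hq) x j l y
  have hY : ∀ k l k' l', addCopy Y (snoc₂ a (k, l)) (snoc₂ b (k', l')) =
      if l = l' then Y (Fin.snoc a k) (Fin.snoc b k') else 0 := fun k l k' l' =>
    addCopy_snoc _ _ _ _ _
  rw [rTraceLast_snoc, addCopy_snoc]
  simp only [mul_coeMat_leg2_last, coeMat_leg2_last_mul, Fintype.sum_prod_type, hY, smul_ite,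
    smul_zero, Finset.sum_ite_eq', Finset.mem_univ, if_true, Finset.smul_sum,
    smul_smul]
  calc _ = ∑ i, ∑ j, (∑ c, ∑ r, ∑ z, R (x, c) (j, r) * R⁻¹ (i, r) (y, z) * matC Ψ z c) •
        Y (Fin.snoc a j) (Fin.snoc b i) := by
        simp only [Finset.sum_smul]
        rw [Finset.sum_comm_cycle]
        refine Finset.sum_congr rfl fun i _ => ?_
        rw [Finset.sum_congr rfl fun z _ => Finset.sum_comm_cycle, Finset.sum_comm]
        refine Finset.sum_congr rfl fun j _ => ?_
        rw [Finset.sum_comm_cycle, Finset.sum_comm_cycle]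
        refine Finset.sum_congr rfl fun c _ => Finset.sum_congr rfl fun r _ =>
          Finset.sum_congr rfl fun z _ => ?_
        congr 1
        ring
    _ = _ := by
        simp only [h1]
        split_ifs with hxy
        · rfl
        · simp

end PartialTrace

/-! ### Transport along homomorphisms, and cyclicity of functionals. -/

section Maps

variable {K B B' : Type*} [Field K] [Ring B] [Algebra K B] [Ring B'] [Algebra K B']
variable {q : K} {M : ℕ}

theorem HeckeRelations.map {r : ℕ → B} (h : HeckeRelations q M r) (φ : B →ₐ[K] B') :
    HeckeRelations q M (fun i => φ (r i)) :=
  ⟨fun i hi => by rw [← map_mul, h.sq i hi, map_add, map_one, map_smul],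
    fun i j hij hj => by rw [← map_mul, h.comm i j hij hj, map_mul],
    fun i hi => by rw [← map_mul, ← map_mul, h.braid i hi, map_mul, map_mul]⟩

theorem map_conjSeq (φ : B →ₐ[K] B') (r s : ℕ → B) (x : B) (i : ℕ) :
    φ (conjSeq r s x i) = conjSeq (fun i => φ (r i)) (fun i => φ (s i)) (φ x) i := by
  induction i with
  | zero => rfl
  | succ i ih => simp only [conjSeq, map_mul, ih]

theorem conjSeq_congr {r s r' s' : ℕ → B} (x : B) (i : ℕ) (hr : ∀ j < i, r j = r' j)
    (hs : ∀ j < i, s j = s' j) : conjSeq r s x i = conjSeq r' s' x i := by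
  induction i with
  | zero => rfl
  | succ i ih =>
    rw [conjSeq, conjSeq, ih (fun j hj => hr j (by omega)) (fun j hj => hs j (by omega)),
      hr i (by omega), hs i (by omega)]

theorem map_ascProd (φ : B →ₐ[K] B') (r : ℕ → B) (n : ℕ) :
    φ (ascProd r n) = ascProd (fun i => φ (r i)) n := by
  induction n with
  | zero => exact map_one φ
  | succ n ih => simp only [ascProd, map_mul, ih]

theorem map_descProd (φ : B →ₐ[K] B') (r : ℕ → B) (n : ℕ) :
    φ (descProd r n) = descProd (fun i => φ (r i)) n := by
  induction n with
  | zero => exact map_one φ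
  | succ n ih => simp only [descProd, map_mul, ih]

theorem ascProd_congr {r r' : ℕ → B} (n : ℕ) (h : ∀ i < n, r i = r' i) :
    ascProd r n = ascProd r' n := by
  induction n with
  | zero => rfl
  | succ n ih => rw [ascProd, ascProd, ih fun i hi => h i (by omega), h n (by omega)]

theorem descProd_congr {r r' : ℕ → B} (n : ℕ) (h : ∀ i < n, r i = r' i) :
    descProd r n = descProd r' n := by
  induction n with
  | zero => rfl
  | succ n ih => rw [descProd, descProd, ih fun i hi => h i (by omega), h n (by omega)]

theorem map_stringProd (φ : B →ₐ[K] B') (l : ℕ → ℕ → B) (a n : ℕ) :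
    φ (stringProd l a n) = stringProd (fun i a => φ (l i a)) a n := by
  induction n with
  | zero => exact map_one φ
  | succ n ih => rw [stringProd_succ, map_mul, ih, stringProd_succ]

theorem stringProd_congr {l l' : ℕ → ℕ → B} (a n : ℕ) (h : ∀ i < n, ∀ a, l i a = l' i a) :
    stringProd l a n = stringProd l' a n := by
  simpa using mul_stringProd (z := (1 : B)) n a fun i hi a => by simpa using h i hi a

/-- A linear functional that is cyclic for the generators is cyclic for the antisymmetrizer. -/
theorem antisym_cyclic {D : Type*} [AddCommGroup D] [Module K D] (τ : B →ₗ[K] D) {f : ℕ → B}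
    (k : ℕ) (h : ∀ i, i + 1 < k → ∀ x, τ (x * f i) = τ (f i * x)) (x : B) :
    τ (x * antisym q f k) = τ (antisym q f k * x) := by
  induction k generalizing x with
  | zero => simp [antisym]
  | succ k ih =>
    rcases k with _ | k
    · simp [antisym]
    · have h1 := ih fun i hi => h i (by omega)
      have h2 : ∀ x, τ (x * baxter q (k + 1) (f k)) = τ (baxter q (k + 1) (f k) * x) := fun x => by
        simp only [baxter, mul_sub, sub_mul, mul_smul_comm, smul_mul_assoc, map_sub, map_smul,
          h k (by omega), mul_one, one_mul]
      rw [antisym, mul_smul_comm, smul_mul_assoc, map_smul, map_smul, ← mul_assoc, h1, ← mul_assoc,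
        ← mul_assoc, h2, ← mul_assoc, h1]
      simp only [mul_assoc]

end Maps

/-! ### The Hecke generators `R_i` and the skew-symmetrizer. -/

section Generators

variable {K : Type*} [Field K] {N : ℕ} {q : K} {R Ψ : Matrix (Fin N × Fin N) (Fin N × Fin N) K}

/-- `R` acting in the copies number `i` and `i + 1` of `V`. -/
def gen (R : Matrix (Fin N × Fin N) (Fin N × Fin N) K) (n i : ℕ) :
    Matrix (Fin n → Fin N) (Fin n → Fin N) K :=
  -- The value `1` out of range keeps the sequence total and inverse to the one for `R⁻¹` at every
  -- index.
  if h : i + 1 < n then leg2 ⟨i, by omega⟩ ⟨i + 1, h⟩ R else 1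

theorem gen_of_lt {n i : ℕ} (h : i + 1 < n) : gen R n i = leg2 ⟨i, by omega⟩ ⟨i + 1, h⟩ R :=
  dif_pos h

theorem gen_last (n : ℕ) :
    gen R (n + 2) n = leg2 (Fin.last n).castSucc (Fin.last (n + 1)) R :=
  gen_of_lt (by omega)

theorem addCopy_gen {n i : ℕ} (h : i + 1 < n) : addCopy (gen R n i) = gen R (n + 1) i := by
  rw [gen_of_lt h, addCopy_leg2, gen_of_lt (by omega)]
  rfl

theorem gen_mul_inv (hR : R * R⁻¹ = 1) (n i : ℕ) : gen R n i * gen R⁻¹ n i = 1 := by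
  unfold gen
  split_ifs
  · rw [← leg2_mul (by simp), hR, leg2_one]
  · rw [one_mul]

theorem gen_inv_mul (hR : R⁻¹ * R = 1) (n i : ℕ) : gen R⁻¹ n i * gen R n i = 1 := by
  unfold gen
  split_ifs
  · rw [← leg2_mul (by simp), hR, leg2_one]
  · rw [one_mul]

theorem IsHeckeSymmetry.heckeRelations (hR : IsHeckeSymmetry q R) (hq : q ≠ 0) (n : ℕ) :
    HeckeRelations q (n - 1) (gen R n) := by
  refine ⟨fun i hi => ?_, fun i j hij hj => ?_, fun i hi => ?_⟩
  · rw [gen_of_lt (by omega), ← leg2_mul (by simp), hR.sq hq, leg2_add, leg2_one, leg2_smul]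
  · rw [gen_of_lt (by omega), gen_of_lt (by omega)]
    refine leg2_commute_leg2 ?_ ?_ ?_ ?_ _ _ fun a b c d => mul_comm _ _ <;>
      simp only [ne_eq, Fin.mk.injEq] <;> omega
  · rw [gen_of_lt (by omega), gen_of_lt (by omega)]
    let f : Fin 3 → Fin n := fun j => ⟨i + j, by omega⟩
    have hf : f.Injective := fun a b h => by
      simp only [f, Fin.mk.injEq] at h
      exact Fin.ext (by omega)
    have := congrArg (legs f) hR.braiding
    simp only [legs_mul hf, legs_leg2 hf] at this
    exact this

theorem skewSymmetrizer_eq_antisym (n : ℕ) :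
    skewSymmetrizer q R n = antisym q (gen R n) n := by
  induction n with
  | zero => rfl
  | succ n ih =>
    rcases n with _ | n
    · rfl
    · have h : addCopy (skewSymmetrizer q R (n + 1)) = antisym q (gen R (n + 2)) (n + 1) := by
        rw [ih, ← addCopyHom_apply K, map_antisym]
        refine antisym_congr _ fun i hi => ?_
        rw [addCopyHom_apply, addCopy_gen hi]
      rw [skewSymmetrizer, h, antisym, gen_last]
      rfl

end Generators

/-! ### The `R`-trace in all copies but the first. -/

section Tail

variable {K : Type*} [Field K] {N : ℕ} {A : Type*} [Ring A] [Algebra K A]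
  (C : Matrix (Fin N) (Fin N) K)

theorem rTraceTail_succ (k : ℕ) (M : Matrix (Fin (k + 2) → Fin N) (Fin (k + 2) → Fin N) A⟦X⟧) :
    rTraceTail C (k + 1) M = rTraceTail C k (rTraceLast C M) := rfl

theorem rTraceTail_add (k : ℕ) (M M' : Matrix (Fin (k + 1) → Fin N) (Fin (k + 1) → Fin N) A⟦X⟧) :
    rTraceTail C k (M + M') = rTraceTail C k M + rTraceTail C k M' := by
  induction k with
  | zero => rfl
  | succ k ih => rw [rTraceTail, rTraceLast_add, ih]; rfl

theorem rTraceTail_smul (k : ℕ) (c : K)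
    (M : Matrix (Fin (k + 1) → Fin N) (Fin (k + 1) → Fin N) A⟦X⟧) :
    rTraceTail C k (c • M) = c • rTraceTail C k M := by
  induction k with
  | zero => rfl
  | succ k ih => rw [rTraceTail, rTraceLast_smul, ih]; rfl

/-- The `R`-trace in all copies but the first, as a linear map. -/
noncomputable def rTraceTailHom (k : ℕ) :
    Matrix (Fin (k + 1) → Fin N) (Fin (k + 1) → Fin N) A⟦X⟧ →ₗ[K] Matrix (Fin N) (Fin N) A⟦X⟧ where
  toFun := rTraceTail C k
  map_add' := rTraceTail_add C k
  map_smul' := rTraceTail_smul C k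

theorem rTraceTail_leg1_mul (k : ℕ) (X : Matrix (Fin N) (Fin N) A⟦X⟧)
    (M : Matrix (Fin (k + 1) → Fin N) (Fin (k + 1) → Fin N) A⟦X⟧) :
    rTraceTail C k (leg1 0 X * M) = X * rTraceTail C k M := by
  induction k with
  | zero =>
    ext1 i j
    simp only [rTraceTail, Matrix.of_apply, Matrix.mul_apply, leg1]
    rw [← (Equiv.funUnique (Fin 1) (Fin N)).symm.sum_comp]
    refine Finset.sum_congr rfl fun c _ => ?_
    rw [if_pos (by intro r hr; exact absurd (Fin.fin_one_eq_zero r) hr)]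
    rfl
  | succ k ih =>
    have h : (leg1 0 X : Matrix (Fin (k + 2) → Fin N) (Fin (k + 2) → Fin N) A⟦X⟧) =
        addCopy (leg1 0 X) := (addCopy_leg1 0 X).symm
    rw [rTraceTail, h, rTraceLast_addCopy_mul, ih]
    rfl

variable {C} {R Ψ : Matrix (Fin N × Fin N) (Fin N × Fin N) K} {q : K}

theorem addCopy_coeMat_gen {n i : ℕ} (h : i + 1 < n) :
    addCopy (coeMat (gen R n i) : Matrix _ _ A) = coeMat (gen R (n + 1) i) := by
  rw [← coeMat_addCopy, addCopy_gen h]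

/-- Traces over copies beyond the generator leave it alone; once it acts in the last two copies,
`rTraceLast_rTraceLast_comm` applies. The index `i + 1` keeps it away from the first copy, which is
not traced. -/
theorem rTraceTail_gen_comm (hC : R * Matrix.kronecker C C = Matrix.kronecker C C * R) (k i : ℕ)
    (hi : i + 1 < k) (M : Matrix (Fin (k + 1) → Fin N) (Fin (k + 1) → Fin N) A⟦X⟧) :
    rTraceTail C k (M * coeMat (gen R (k + 1) (i + 1))) =
      rTraceTail C k (coeMat (gen R (k + 1) (i + 1)) * M) := by
  induction k with
  | zero => omega
  | succ k ih =>
    rcases Nat.lt_or_ge (i + 1) k with hik | hik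
    · rw [rTraceTail, rTraceTail, ← addCopy_coeMat_gen (by omega), rTraceLast_mul_addCopy,
        rTraceLast_addCopy_mul, ih hik]
    · obtain rfl : k = i + 1 := by omega
      rw [rTraceTail, rTraceTail, rTraceTail, rTraceTail, gen_last, rTraceLast_rTraceLast_comm hC]

theorem addCopy_ascProd_gen (k : ℕ) :
    addCopy (ascProd (fun i => (coeMat (gen R (k + 1) i) : Matrix _ _ A)) k) =
      ascProd (fun i => (coeMat (gen R (k + 2) i) : Matrix _ _ A)) k := by
  rw [← addCopyHom_apply K, map_ascProd]
  refine ascProd_congr _ fun i hi => ?_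
  rw [addCopyHom_apply, addCopy_coeMat_gen (by omega)]

theorem addCopy_descProd_gen (k : ℕ) :
    addCopy (descProd (fun i => (coeMat (gen R (k + 1) i) : Matrix _ _ A)) k) =
      descProd (fun i => (coeMat (gen R (k + 2) i) : Matrix _ _ A)) k := by
  rw [← addCopyHom_apply K, map_descProd]
  refine descProd_congr _ fun i hi => ?_
  rw [addCopyHom_apply, addCopy_coeMat_gen (by omega)]

theorem addCopy_descProd_gen_succ (k : ℕ) :
    addCopy (descProd (fun i => (coeMat (gen R (k + 2) (i + 1)) : Matrix _ _ A)) k) =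
      descProd (fun i => (coeMat (gen R (k + 3) (i + 1)) : Matrix _ _ A)) k := by
  rw [← addCopyHom_apply K, map_descProd]
  refine descProd_congr _ fun i hi => ?_
  rw [addCopyHom_apply, addCopy_coeMat_gen (by omega)]

/-- `Tr_{R(2 … k+2)} (Z Y Z⁻¹) = Tr_{R(1 … k+1)} Y · I` for `Z = R₁ … R_{k+1}`. -/
theorem IsSkewInverse.rTraceTail_conj (h : IsSkewInverse R Ψ) (hR : IsHeckeSymmetry q R)
    (hq : q ≠ 0) (k : ℕ) (Y : Matrix (Fin (k + 1) → Fin N) (Fin (k + 1) → Fin N) A⟦X⟧) :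
    rTraceTail (matC Ψ) (k + 1) (ascProd (fun i => coeMat (gen R (k + 2) i)) (k + 1) * addCopy Y *
      descProd (fun i => coeMat (gen R⁻¹ (k + 2) i)) (k + 1)) =
      Matrix.scalar (Fin N) (rTrace (matC Ψ) (rTraceTail (matC Ψ) k Y)) := by
  -- Tracing the last copy removes the innermost factor of `Z`; the outer factors do not touch that
  -- copy and come out of the trace.
  have step : ∀ (k : ℕ) (Y : Matrix (Fin (k + 1) → Fin N) (Fin (k + 1) → Fin N) A⟦X⟧),
      rTraceLast (matC Ψ) (ascProd (fun i => coeMat (gen R (k + 2) i)) (k + 1) * addCopy Y *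
        descProd (fun i => coeMat (gen R⁻¹ (k + 2) i)) (k + 1)) =
      ascProd (fun i => coeMat (gen R (k + 1) i)) k * addCopy (rTraceLast (matC Ψ) Y) *
        descProd (fun i => coeMat (gen R⁻¹ (k + 1) i)) k := fun k Y => by
    rw [ascProd, descProd, ← addCopy_ascProd_gen, ← addCopy_descProd_gen, mul_assoc, mul_assoc,
      rTraceLast_addCopy_mul, ← mul_assoc, ← mul_assoc, rTraceLast_mul_addCopy, gen_last, gen_last,
      h.rTraceLast_conj hR hq, ← mul_assoc]
  induction k with
  | zero =>
    rw [rTraceTail_succ, step]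
    simp only [ascProd, descProd, one_mul, mul_one]
    ext1 i j
    rw [Matrix.scalar_apply, Matrix.diagonal_apply]
    refine if_congr Iff.rfl ?_ rfl
    simp only [rTrace, rTraceLast, Matrix.of_apply]
    refine Finset.sum_congr rfl fun x _ => Finset.sum_congr rfl fun y _ => ?_
    simp only [rTraceTail, Matrix.of_apply]
    congr 2
  | succ k ih => rw [rTraceTail_succ, step, ih]; rfl

/-- `Tr_{R(2 … k+2)} (Z Y Z⁻¹ R₁) = Tr_{R(2 … k+1)} Y` for `Z = R₁ … R_{k+1}`. -/
theorem IsSkewInverse.rTraceTail_conj_mul (h : IsSkewInverse R Ψ) (hR : IsHeckeSymmetry q R)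
    (hq : q ≠ 0) (k : ℕ) (Y : Matrix (Fin (k + 1) → Fin N) (Fin (k + 1) → Fin N) A⟦X⟧) :
    rTraceTail (matC Ψ) (k + 1) (ascProd (fun i => coeMat (gen R (k + 2) i)) (k + 1) * addCopy Y *
      descProd (fun i => coeMat (gen R⁻¹ (k + 2) (i + 1))) k) = rTraceTail (matC Ψ) k Y := by
  induction k with
  | zero =>
    -- With the inverse of `R₁` cancelled, the last remaining trace is that of a bare `R`, which is
    -- `I`.
    rw [rTraceTail_succ, descProd, mul_one, rTraceLast_mul_addCopy, ascProd, ascProd, one_mul, gen_last,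
      h.rTraceLast_leg2, one_mul]
  | succ k ih =>
    rw [rTraceTail_succ, ascProd, descProd, ← addCopy_ascProd_gen, ← addCopy_descProd_gen_succ,
      mul_assoc, mul_assoc, rTraceLast_addCopy_mul, ← mul_assoc, ← mul_assoc,
      rTraceLast_mul_addCopy, gen_last, gen_last, h.rTraceLast_conj hR hq, ← mul_assoc, ih]
    rfl

end Tail

/-! ### The substitution `u ↦ q^{-2j} u`. -/

section Shift

variable {K : Type*} [Field K] {A : Type*} [Ring A] [Algebra K A] {q : K}

@[simp] theorem coeff_shift (j n : ℕ) (f : A⟦X⟧) :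
    PowerSeries.coeff n (shift q j f) = (q ^ (2 * j)) ^ n • PowerSeries.coeff n f := by
  rw [shift, scaleArg, PowerSeries.coeff_mk, neg_mul, zpow_neg, inv_inv]
  norm_cast

theorem shift_mul (j : ℕ) (f g : A⟦X⟧) : shift q j (f * g) = shift q j f * shift q j g := by
  ext n
  rw [coeff_shift, PowerSeries.coeff_mul, PowerSeries.coeff_mul, Finset.smul_sum]
  refine Finset.sum_congr rfl fun p hp => ?_
  rw [coeff_shift, coeff_shift, smul_mul_smul_comm, ← pow_add,
    Finset.HasAntidiagonal.mem_antidiagonal.mp hp]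

theorem shift_add (j : ℕ) (f g : A⟦X⟧) : shift q j (f + g) = shift q j f + shift q j g := by
  ext n; simp

theorem shift_smul (j : ℕ) (c : K) (f : A⟦X⟧) : shift q j (c • f) = c • shift q j f := by
  ext n; simp [smul_comm c]

theorem shift_one (j : ℕ) : shift q j (1 : A⟦X⟧) = 1 := by
  ext n
  rw [coeff_shift, PowerSeries.coeff_one]
  split_ifs with h <;> simp [h]

theorem shift_shift (j k : ℕ) (f : A⟦X⟧) : shift q j (shift q k f) = shift q (k + j) f := by
  ext n
  rw [coeff_shift, coeff_shift, coeff_shift, smul_smul, ← mul_pow, ← pow_add]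
  congr 3; ring

/-- `f(u) ↦ f(q^{-2j} u)` as a homomorphism of algebras. -/
noncomputable def shiftHom (q : K) (A : Type*) [Ring A] [Algebra K A] (j : ℕ) :
    A⟦X⟧ →ₐ[K] A⟦X⟧ :=
  AlgHom.ofLinearMap
    { toFun := shift q j
      map_add' := shift_add j
      map_smul' := shift_smul j } (shift_one j) (shift_mul j)

theorem map_shift_mul {ι : Type*} [Fintype ι] (j : ℕ) (M M' : Matrix ι ι A⟦X⟧) :
    (M * M').map (shift q j) = M.map (shift q j) * M'.map (shift q j) :=
  Matrix.map_mul (f := (shiftHom q A j : A⟦X⟧ →+* A⟦X⟧))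

variable {N : ℕ} (L : Matrix (Fin N) (Fin N) A⟦X⟧)

theorem map_shift_lpow_succ (p j : ℕ) :
    (lpow q L (p + 1)).map (shift q j) =
      L.map (shift q (p + j)) * (lpow q L p).map (shift q j) := by
  rw [lpow, map_shift_mul, Matrix.map_map]
  congr 2
  funext f
  exact shift_shift _ _ _

theorem map_shift_lpow_zero (j : ℕ) : (lpow q L 0).map (shift q j) = 1 := by
  rw [lpow, Matrix.map_one _ (by ext n; simp) (shift_one j)]

end Shift

/-! ### The recursion between skew-powers. -/

section Strings

variable {K : Type*} [Field K] {N : ℕ} {A : Type*} [Ring A] [Algebra K A]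
  {q : K} {R Ψ : Matrix (Fin N × Fin N) (Fin N × Fin N) K} {L : Matrix (Fin N) (Fin N) A⟦X⟧}

/-- The relations between `L(q^{-2a} u)` and `L(q^{-2(a+m)} u)` in two copies of `V`. -/
def IsStringMatrix (q : K) (R : Matrix (Fin N × Fin N) (Fin N × Fin N) K)
    (L : Matrix (Fin N) (Fin N) A⟦X⟧) : Prop :=
  ∀ a m : ℕ, baxter q m (coeMat (leg2 0 1 R)) * leg1 0 (L.map (shift q a)) *
      coeMat (leg2 0 1 R) * leg1 0 (L.map (shift q (a + m))) =
    leg1 0 (L.map (shift q (a + m))) * coeMat (leg2 0 1 R) * leg1 0 (L.map (shift q a)) *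
      baxter q m (coeMat (leg2 0 1 R) : Matrix (Fin 2 → Fin N) (Fin 2 → Fin N) A⟦X⟧)

/-- `L(q^{-2a} u)` acting in the first of `n` copies of `V`. -/
noncomputable def firstLeg (q : K) (L : Matrix (Fin N) (Fin N) A⟦X⟧) (n a : ℕ) :
    Matrix (Fin n → Fin N) (Fin n → Fin N) A⟦X⟧ :=
  if h : 0 < n then leg1 ⟨0, h⟩ (L.map (shift q a)) else 1

theorem addCopy_firstLeg {n : ℕ} (h : 0 < n) (a : ℕ) :
    addCopy (firstLeg q L n a) = firstLeg q L (n + 1) a := by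
  rw [firstLeg, firstLeg, dif_pos h, dif_pos (by omega), addCopy_leg1]
  rfl

/-- The matrix `L_{\overline{i+1}}(q^{-2a} u)` in `n` copies of `V`. -/
noncomputable def barLeg (q : K) (R : Matrix (Fin N × Fin N) (Fin N × Fin N) K)
    (L : Matrix (Fin N) (Fin N) A⟦X⟧) (n i a : ℕ) :
    Matrix (Fin n → Fin N) (Fin n → Fin N) A⟦X⟧ :=
  conjSeq (fun j => coeMat (gen R n j)) (fun j => coeMat (gen R⁻¹ n j)) (firstLeg q L n a) i

theorem addCopy_barLeg {n i : ℕ} (h : i < n) (a : ℕ) :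
    addCopy (barLeg q R L n i a) = barLeg q R L (n + 1) i a := by
  rw [← addCopyHom_apply K, barLeg, map_conjSeq, addCopyHom_apply, addCopy_firstLeg (by omega)]
  refine conjSeq_congr _ _ (fun j hj => ?_) fun j hj => ?_ <;>
    rw [addCopyHom_apply, addCopy_coeMat_gen (by omega)]

theorem lbar_eq_barLeg (i a : ℕ) :
    lbar R (L.map (shift q a)) i = barLeg q R L (i + 1) i a := by
  induction i with
  | zero => rw [barLeg, conjSeq, firstLeg, dif_pos (by omega)]; rfl
  | succ i ih =>
    rw [lbar, ih, addCopy_barLeg (by omega), ← gen_last, ← gen_last]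
    rfl

theorem lstring_eq_stringProd (n : ℕ) :
    lstring q R L n = stringProd (barLeg q R L n) 0 n := by
  induction n with
  | zero => rfl
  | succ n ih =>
    rw [lstring, ih, lbar_eq_barLeg, stringProd_succ, zero_add, ← addCopyHom_apply K,
      map_stringProd]
    congr 1
    refine stringProd_congr _ _ fun i hi a => ?_
    rw [addCopyHom_apply, addCopy_barLeg hi]

theorem coeMat_mul_coeMat {ι : Type*} [Fintype ι] [DecidableEq ι] {X Y : Matrix ι ι K}
    (h : X * Y = 1) : (coeMat X * coeMat Y : Matrix ι ι A) = 1 := by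
  rw [← coeMatHom_apply, ← coeMatHom_apply, ← map_mul, h, map_one]

theorem IsHeckeSymmetry.heckeRelations_coeMat (hR : IsHeckeSymmetry q R) (hq : q ≠ 0) (n : ℕ) :
    HeckeRelations q (n - 1) (fun i => (coeMat (gen R n i) : Matrix _ _ A)) :=
  (hR.heckeRelations hq n).map (coeMatHom K A _)

theorem firstLeg_comm (n a j : ℕ) (h1 : 1 ≤ j) (h2 : j < n - 1) :
    coeMat (gen R n j) * firstLeg q L n a = firstLeg q L n a * coeMat (gen R n j) := by
  have hc : ∀ x y i k, (coeMat R : Matrix _ _ A⟦X⟧) x y * L.map (shift q a) i k =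
      L.map (shift q a) i k * (coeMat R : Matrix _ _ A⟦X⟧) x y := fun x y i k => by
    rw [coeMat, Matrix.map_apply]
    exact Algebra.commutes _ _
  rw [firstLeg, dif_pos (by omega), gen_of_lt (by omega), coeMat_leg2]
  exact leg2_commute_leg1 (by simp only [ne_eq, Fin.mk.injEq]; omega)
    (by simp only [ne_eq, Fin.mk.injEq]; omega) _ _ hc

theorem IsStringMatrix.stringRelations (hL : IsStringMatrix q R L) (hR : IsHeckeSymmetry q R)
    (hq : q ≠ 0) (n : ℕ) :
    StringRelations q (n - 1) (fun i => coeMat (gen R n i)) (barLeg q R L n) := by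
  have hrs : ∀ i, (coeMat (gen R n i) * coeMat (gen R⁻¹ n i) : Matrix _ _ A⟦X⟧) = 1 := fun i =>
    coeMat_mul_coeMat (gen_mul_inv (hR.mul_inv hq) n i)
  have hsr : ∀ i, (coeMat (gen R⁻¹ n i) * coeMat (gen R n i) : Matrix _ _ A⟦X⟧) = 1 := fun i =>
    coeMat_mul_coeMat (gen_inv_mul (hR.inv_mul hq) n i)
  refine (hR.heckeRelations_coeMat hq n).stringRelations (fun i _ => hrs i) (fun i _ => hsr i)
    (fun a j h1 h2 => firstLeg_comm n a j h1 h2) fun hn a m => ?_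
  let f : Fin 2 → Fin n := Fin.castLE (by omega)
  have hf : f.Injective := Fin.castLE_injective _
  have e1 : ∀ a, legs f (leg1 0 (L.map (shift q a))) = firstLeg q L n a := fun a => by
    rw [legs_leg1 hf, firstLeg, dif_pos (by omega)]; rfl
  have e2 : legs f (coeMat (leg2 0 1 R) : Matrix _ _ A⟦X⟧) = coeMat (gen R n 0) := by
    rw [← coeMat_legs, legs_leg2 hf, gen_of_lt (by omega)]; rfl
  have e3 : legs f (baxter q m (coeMat (leg2 0 1 R) : Matrix _ _ A⟦X⟧)) =
      baxter q m (coeMat (gen R n 0)) := by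
    rw [← e2]
    change legsHom K hf _ = _
    rw [baxter, map_sub, map_smul, map_smul, map_one]
    rfl
  have key := congrArg (legs f) (hL a m)
  simp only [legs_mul hf, e1, e2, e3] at key
  have hc := mul_baxter (q := q) (z := coeMat (gen R⁻¹ n 0)) m
    ((hsr 0).trans (hrs 0).symm)
  calc _ = (baxter q m (coeMat (gen R n 0)) * firstLeg q L n a * coeMat (gen R n 0) *
        firstLeg q L n (a + m)) * coeMat (gen R⁻¹ n 0) := by simp only [mul_assoc]
    _ = firstLeg q L n (a + m) * coeMat (gen R n 0) * firstLeg q L n a *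
        (baxter q m (coeMat (gen R n 0)) * coeMat (gen R⁻¹ n 0)) := by
      rw [key]; simp only [mul_assoc]
    _ = _ := by rw [← hc]; simp only [mul_assoc]

theorem lskew_succ_eq (n : ℕ) : lskew q R (matC Ψ) L (n + 1) = rTraceTail (matC Ψ) n
    (antisym q (fun i => coeMat (gen R (n + 1) i)) (n + 1) *
      stringProd (barLeg q R L (n + 1)) 0 (n + 1)) := by
  rw [lskew, skewSymmetrizer_eq_antisym, ← coeMatHom_apply, map_antisym, lstring_eq_stringProd]
  rfl

/-- The antisymmetrized string in the last copies of `V`. -/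
noncomputable def tailString (q : K) (R : Matrix (Fin N × Fin N) (Fin N × Fin N) K)
    (L : Matrix (Fin N) (Fin N) A⟦X⟧) (k : ℕ) :
    Matrix (Fin (k + 2) → Fin N) (Fin (k + 2) → Fin N) A⟦X⟧ :=
  antisym q (fun i => coeMat (gen R (k + 2) (i + 1))) (k + 1) *
    stringProd (fun i => barLeg q R L (k + 2) (i + 1)) 0 (k + 1)

/-- Conjugation by `Z = R₁ ⋯ R_{k+1}` moves each generator and each factor of the string one copy to
the right. -/
theorem IsStringMatrix.tailString_eq (hL : IsStringMatrix q R L) (hR : IsHeckeSymmetry q R)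
    (hq : q ≠ 0) (k : ℕ) :
    tailString q R L k = ascProd (fun i => coeMat (gen R (k + 2) i)) (k + 1) *
      addCopy (antisym q (fun i => coeMat (gen R (k + 1) i)) (k + 1) *
        stringProd (barLeg q R L (k + 1)) 0 (k + 1)) *
      descProd (fun i => coeMat (gen R⁻¹ (k + 2) i)) (k + 1) := by
  have hS := hL.stringRelations hR hq (k + 2)
  have hrs : ∀ i, (coeMat (gen R (k + 2) i) * coeMat (gen R⁻¹ (k + 2) i) : Matrix _ _ A⟦X⟧) = 1 :=
    fun i => coeMat_mul_coeMat (gen_mul_inv (hR.mul_inv hq) _ i)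
  have hsr : ∀ i, (coeMat (gen R⁻¹ (k + 2) i) * coeMat (gen R (k + 2) i) : Matrix _ _ A⟦X⟧) = 1 :=
    fun i => coeMat_mul_coeMat (gen_inv_mul (hR.inv_mul hq) _ i)
  have hadd : addCopy (antisym q (fun i => (coeMat (gen R (k + 1) i) : Matrix _ _ A⟦X⟧)) (k + 1) *
        stringProd (barLeg q R L (k + 1)) 0 (k + 1)) =
      antisym q (fun i => coeMat (gen R (k + 2) i)) (k + 1) *
        stringProd (barLeg q R L (k + 2)) 0 (k + 1) := by
    rw [← addCopyHom_apply K, map_mul, map_antisym, map_stringProd]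
    congr 1
    · exact antisym_congr _ fun i hi => by rw [addCopyHom_apply, addCopy_coeMat_gen hi]
    · exact stringProd_congr _ _ fun i hi a => by rw [addCopyHom_apply, addCopy_barLeg hi]
  have h1 : ascProd (fun i => (coeMat (gen R (k + 2) i) : Matrix _ _ A⟦X⟧)) (k + 1) *
      antisym q (fun i => coeMat (gen R (k + 2) i)) (k + 1) =
      antisym q (fun i => coeMat (gen R (k + 2) (i + 1))) (k + 1) *
        ascProd (fun i => coeMat (gen R (k + 2) i)) (k + 1) :=
    mul_antisym _ fun i hi => hS.hecke.ascProd_mul (k + 1) i (by omega) hi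
  have h2 : ascProd (fun i => coeMat (gen R (k + 2) i)) (k + 1) *
      stringProd (barLeg q R L (k + 2)) 0 (k + 1) =
      stringProd (fun i => barLeg q R L (k + 2) (i + 1)) 0 (k + 1) *
        ascProd (fun i => coeMat (gen R (k + 2) i)) (k + 1) :=
    mul_stringProd _ _ fun i hi a => hS.hecke.ascProd_mul_conjSeq (fun i _ => hrs i)
      (fun i _ => hsr i) (fun j h1 h2 => firstLeg_comm (k + 2) a j h1 h2) (k + 1) i (by omega) hi
  rw [hadd, ← mul_assoc, h1, mul_assoc (antisym q _ _), h2, ← mul_assoc, ← tailString, mul_assoc,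
    ascProd_mul_descProd (M := k + 1) (fun i _ => hrs i) (k + 1) le_rfl, mul_one]

theorem IsStringMatrix.rTraceTail_tailString (hL : IsStringMatrix q R L)
    (hR : IsHeckeSymmetry q R) (hΨ : IsSkewInverse R Ψ) (hq : q ≠ 0) (k : ℕ) :
    rTraceTail (matC Ψ) (k + 1) (tailString q R L k) =
      Matrix.scalar (Fin N) (elem q R (matC Ψ) L (k + 1)) := by
  rw [hL.tailString_eq hR hq, hΨ.rTraceTail_conj hR hq, elem, lskew_succ_eq]

theorem IsStringMatrix.rTraceTail_tailString_mul (hL : IsStringMatrix q R L)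
    (hR : IsHeckeSymmetry q R) (hΨ : IsSkewInverse R Ψ) (hq : q ≠ 0) (k : ℕ) :
    rTraceTail (matC Ψ) (k + 1) (tailString q R L k * coeMat (gen R (k + 2) 0)) =
      lskew q R (matC Ψ) L (k + 1) := by
  rw [hL.tailString_eq hR hq, descProd_succ, mul_assoc, mul_assoc _ (coeMat (gen R⁻¹ (k + 2) 0)),
    coeMat_mul_coeMat (gen_inv_mul (hR.inv_mul hq) _ 0), mul_one, hΨ.rTraceTail_conj_mul hR hq,
    lskew_succ_eq]

/-- The trailing antisymmetrizer is cycled to the front and absorbed by the string; the two terms of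
`q^{k+1} - (k+1)_q R₁` then give the two traces already known. -/
theorem IsStringMatrix.rTraceTail_antisym (hL : IsStringMatrix q R L) (hq : IsGeneric q)
    (hR : IsHeckeSymmetry q R) (hΨ : IsSkewInverse R Ψ) (k : ℕ) :
    rTraceTail (matC Ψ) (k + 1) (tailString q R L k *
        baxter q (k + 1) (coeMat (gen R (k + 2) 0)) *
        antisym q (fun i => coeMat (gen R (k + 2) (i + 1))) (k + 1)) =
      q ^ (k + 1) • Matrix.scalar (Fin N) (elem q R (matC Ψ) L (k + 1)) -
        qint q (k + 1) • lskew q R (matC Ψ) L (k + 1) := by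
  have hS := hL.stringRelations hR hq.1 (k + 2)
  have hPP : antisym q (fun i => (coeMat (gen R (k + 2) (i + 1)) : Matrix _ _ A⟦X⟧)) (k + 1) *
      tailString q R L k = tailString q R L k := by
    rw [tailString, ← mul_assoc]
    congr 1
    exact mul_antisym_of_absorb hq _ fun i hi =>
      (hS.hecke.tail.antisym_absorb hq (k + 1) i hi).2
  have hcyc := antisym_cyclic (q := q) (rTraceTailHom (A := A) (matC Ψ) (k + 1))
    (f := fun i => coeMat (gen R (k + 2) (i + 1))) (k + 1) fun i hi x =>
      rTraceTail_gen_comm (hΨ.kronecker_matC_comm hR hq.1) (k + 1) i hi x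
  change rTraceTailHom (matC Ψ) (k + 1) _ = _
  rw [hcyc, ← mul_assoc, hPP, baxter, mul_sub, mul_smul_comm, mul_smul_comm, mul_one, map_sub,
    map_smul, map_smul, ← hL.rTraceTail_tailString hR hΨ hq.1,
    ← hL.rTraceTail_tailString_mul hR hΨ hq.1]
  rfl

theorem lskew_one : lskew q R (matC Ψ) L 1 = L.map (shift q 0) := by
  have h1 : rTraceTail (matC Ψ) 0
      (1 : Matrix (Fin 1 → Fin N) (Fin 1 → Fin N) A⟦X⟧) = 1 := by
    ext1 i j
    simp [rTraceTail, Matrix.one_apply, funext_iff]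
  have h2 := rTraceTail_leg1_mul (matC Ψ) 0 (L.map (shift q 0)) 1
  rw [mul_one, h1, mul_one] at h2
  rw [lskew_succ_eq]
  simp only [antisym, stringProd, mul_one, one_mul, barLeg, conjSeq, firstLeg]
  rw [dif_pos (by omega)]
  exact h2

/-- The recursion between the skew-powers of `L(u)`. -/
theorem IsStringMatrix.lskew_succ (hL : IsStringMatrix q R L) (hq : IsGeneric q)
    (hR : IsHeckeSymmetry q R) (hΨ : IsSkewInverse R Ψ) (n : ℕ) :
    qint q (n + 1) • lskew q R (matC Ψ) L (n + 1) = L.map (shift q n) *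
      (q ^ n • Matrix.scalar (Fin N) (elem q R (matC Ψ) L n) -
        qint q n • lskew q R (matC Ψ) L n) := by
  rcases n with _ | k
  -- The conventional value of `lskew` at `0` drops out, since `0_q = 0`.
  · have : Matrix.scalar (Fin N) (elem q R (matC Ψ) L 0) = 1 := map_one _
    rw [this, zero_add, lskew_one, hq.qint_one, qint_zero, zero_smul, one_smul, pow_zero, one_smul,
      sub_zero, mul_one]
  · rw [← hL.rTraceTail_antisym hq hR hΨ, lskew_succ_eq,
      (hL.stringRelations hR hq.1 (k + 2)).antisym_mul_stringProd_eq hq k 0, rTraceTail_smul,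
      smul_smul, mul_inv_cancel₀ (hq.qint_ne_zero (by omega)), one_smul, zero_add,
      ← rTraceTail_leg1_mul, tailString, barLeg, conjSeq, firstLeg, dif_pos (by omega)]
    rfl

end Strings

/-! ### Quadratic relations at proportional arguments. -/

section QuadraticRelations

variable {K B : Type*} [Field K] [Ring B] [Algebra K B]

/-- Evaluation of the relations `(u - v) F(u, v) = c u G(u, v)` at proportional arguments. -/
theorem sum_eval_relations {F G : ℤ → ℤ → B} {c : K}
    (h : ∀ a b, F (a + 1) b - F a (b + 1) = c • G (a + 1) b) (h1 : ∀ b, F (-1) b = 0)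
    (h2 : ∀ a, F a 0 = 0) (α β : K) (n : ℕ) :
    (β - α) • ∑ i ∈ Finset.range (n + 1), (α ^ i * β ^ (n - i)) • F i (n - i : ℕ) =
      (c * β) • ∑ i ∈ Finset.range (n + 1), (α ^ i * β ^ (n - i)) • G i (n - i : ℕ) := by
  have e1 : ∀ i ∈ Finset.range (n + 1), (c * β) • (α ^ i * β ^ (n - i)) • G i (n - i : ℕ) =
      β • (α ^ i * β ^ (n - i)) • F i (n - i : ℕ) -
        β • (α ^ i * β ^ (n - i)) • F (i - 1) ((n - i : ℕ) + 1) := fun i _ => by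
    have := h (i - 1) (n - i : ℕ)
    rw [sub_add_cancel] at this
    rw [← smul_sub, ← smul_sub, this]
    module
  rw [Finset.smul_sum (r := c * β), Finset.sum_congr rfl e1, Finset.sum_sub_distrib, sub_smul,
    ← Finset.smul_sum]
  congr 1
  rw [Finset.sum_range_succ, Finset.sum_range_succ' (n := n)]
  simp only [Nat.cast_zero, zero_sub, h1, smul_zero, add_zero, Nat.sub_self, h2]
  rw [Finset.smul_sum]
  refine Finset.sum_congr rfl fun i hi => ?_
  have hi' := Finset.mem_range.mp hi
  have e2 : n - i = (n - (i + 1)) + 1 := by omega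
  rw [smul_smul, smul_smul, e2]
  congr 1
  · ring
  · push_cast; congr 1; ring

theorem sum_baxter_relations {q : K} (hq : IsGeneric q) {l : ℤ → B} {r : B} (hl : l (-1) = 0)
    (hl0 : l 0 = 1)
    (h : ∀ a b, r * l (a + 1) * r * l b - r * l a * r * l (b + 1) -
        (q - q⁻¹) • (l (a + 1) * r * l b) =
      l b * r * l (a + 1) * r - l (b + 1) * r * l a * r - (q - q⁻¹) • (l b * r * l (a + 1)))
    (α : K) (m n : ℕ) :
    ∑ i ∈ Finset.range (n + 1), (α ^ i * (α * q ^ (2 * m)) ^ (n - i)) •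
        (baxter q m r * l i * r * l (n - i : ℕ)) =
      ∑ i ∈ Finset.range (n + 1), (α ^ i * (α * q ^ (2 * m)) ^ (n - i)) •
        (l (n - i : ℕ) * r * l i * baxter q m r) := by
  by_cases hα : α = 0
  · subst hα
    refine Finset.sum_congr rfl fun i hi => ?_
    rcases Nat.eq_zero_or_pos n with rfl | hn
    · have : i = 0 := by simpa using hi
      subst this
      simp only [Nat.sub_self, Nat.cast_zero, hl0, mul_one, one_mul]
      rw [mul_baxter (q := q) m (rfl : r * r = r * r)]
    · rcases Nat.eq_zero_or_pos i with rfl | hi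
      · simp [zero_pow hn.ne']
      · simp [zero_pow hi.ne']
  have key := sum_eval_relations
    (F := fun a b => r * l a * r * l b - l b * r * l a * r)
    (G := fun a b => l a * r * l b - l b * r * l a) (c := q - q⁻¹)
    (fun a b => by
      have := h a b
      rw [smul_sub, sub_sub_sub_comm]
      rw [sub_eq_iff_eq_add, sub_add, sub_eq_iff_eq_add] at this
      rw [this]; abel)
    (fun b => by simp [hl]) (fun a => by simp [hl0, mul_assoc]) α (α * q ^ (2 * m)) n
  have hs := hq.sub_inv_ne_zero
  have h0 := hq.1
  have e1 : α * q ^ (2 * m) - α = (α * q ^ m * (q - q⁻¹)) * qint q m := by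
    rw [qint, mul_assoc, mul_div_cancel₀ _ hs, inv_pow, mul_assoc, mul_sub,
      mul_inv_cancel₀ (pow_ne_zero m h0)]
    ring
  have e2 : (q - q⁻¹) * (α * q ^ (2 * m)) = (α * q ^ m * (q - q⁻¹)) * q ^ m := by ring
  rw [e1, e2, mul_smul (α * q ^ m * (q - q⁻¹)), mul_smul (α * q ^ m * (q - q⁻¹))] at key
  have key2 := smul_right_injective B
    (mul_ne_zero (mul_ne_zero hα (pow_ne_zero m h0)) hs) key
  simp only [Finset.smul_sum] at key2
  rw [← sub_eq_zero, ← Finset.sum_sub_distrib]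
  rw [eq_comm, ← sub_eq_zero, ← Finset.sum_sub_distrib] at key2
  rw [← key2]
  refine Finset.sum_congr rfl fun i _ => ?_
  simp only [baxter, mul_sub, sub_mul, mul_smul_comm, smul_mul_assoc, mul_one, one_mul, smul_sub]
  module

end QuadraticRelations

section Coefficients

variable {K : Type*} [Field K] {A : Type*} [Ring A] [Algebra K A] {ι : Type*} [Fintype ι]

theorem map_coeff_mul (n : ℕ) (X Y : Matrix ι ι A⟦X⟧) :
    (X * Y).map (PowerSeries.coeff n) = ∑ k ∈ Finset.range (n + 1),
      X.map (PowerSeries.coeff k) * Y.map (PowerSeries.coeff (n - k)) := by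
  ext i j
  simp only [Matrix.map_apply, Matrix.mul_apply, map_sum, PowerSeries.coeff_mul, Matrix.sum_apply,
    Finset.Nat.sum_antidiagonal_eq_sum_range_succ_mk]
  rw [Finset.sum_comm]

theorem map_coeff_mul_reflect (n : ℕ) (X Y : Matrix ι ι A⟦X⟧) :
    (X * Y).map (PowerSeries.coeff n) = ∑ k ∈ Finset.range (n + 1),
      X.map (PowerSeries.coeff (n - k)) * Y.map (PowerSeries.coeff k) := by
  rw [map_coeff_mul, ← Finset.sum_range_reflect]
  refine Finset.sum_congr rfl fun k hk => ?_
  have := Finset.mem_range.mp hk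
  rw [show n + 1 - 1 - k = n - k by omega, show n - (n - k) = k by omega]

theorem map_coeff_coeMat_mul (n : ℕ) (X : Matrix ι ι K) (Y : Matrix ι ι A⟦X⟧) :
    (coeMat X * Y).map (PowerSeries.coeff n) = coeMat X * Y.map (PowerSeries.coeff n) := by
  ext i j
  rw [Matrix.map_apply, coeMat_mul_apply, coeMat_mul_apply, map_sum]
  rfl

theorem map_coeff_mul_coeMat (n : ℕ) (X : Matrix ι ι K) (Y : Matrix ι ι A⟦X⟧) :
    (Y * coeMat X).map (PowerSeries.coeff n) = Y.map (PowerSeries.coeff n) * coeMat X := by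
  ext i j
  rw [Matrix.map_apply, mul_coeMat_apply, mul_coeMat_apply, map_sum]
  rfl

theorem matrix_ext_coeff {ι : Type*} {X Y : Matrix ι ι A⟦X⟧}
    (h : ∀ n, X.map (PowerSeries.coeff n) = Y.map (PowerSeries.coeff n)) : X = Y := by
  ext i j n
  exact congrFun (congrFun (h n) i) j

end Coefficients

section Yangian

variable {K : Type*} [Field K] {N : ℕ} (q : K) (R : Matrix (Fin N × Fin N) (Fin N × Fin N) K)

/-- The coefficient `L₁[k]` in the braided Yangian. -/
noncomputable def yangianL1 (k : ℤ) : Matrix (Fin 2 → Fin N) (Fin 2 → Fin N) (Yangian q R) :=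
  (freeL1 K N k).map (RingQuot.mkAlgHom K (YangianRel q R))

theorem leg1_one {n : ℕ} {A : Type*} [Zero A] [One A] (s : Fin n) :
    leg1 s (1 : Matrix (Fin N) (Fin N) A) = 1 := by
  rw [leg1_eq_legs, ← legs_one ![s]]
  congr 1
  ext a b
  simp only [Matrix.of_apply, Matrix.one_apply]
  exact if_congr ⟨fun h => funext fun i => by rwa [Fin.fin_one_eq_zero i], fun h => congrFun h 0⟩
    rfl rfl

theorem yangianL1_zero : yangianL1 q R 0 = 1 := by
  have : freeL1 K N 0 = 1 := leg1_one 0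
  rw [yangianL1, this, Matrix.map_one _ (map_zero _) (map_one _)]

theorem yangianL1_neg_one : yangianL1 q R (-1) = 0 := by
  ext a b
  have : freeL1 K N (-1) a b = 0 := by
    simp [freeL1, leg1, show freeL K N (-1) = 0 from rfl]
  rw [yangianL1, Matrix.map_apply, this, map_zero]; rfl

theorem yangianL1_rel (a b : ℤ) :
    coeMat (leg2 0 1 R) * yangianL1 q R (a + 1) * coeMat (leg2 0 1 R) * yangianL1 q R b -
        coeMat (leg2 0 1 R) * yangianL1 q R a * coeMat (leg2 0 1 R) * yangianL1 q R (b + 1) -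
        (q - q⁻¹) • (yangianL1 q R (a + 1) * coeMat (leg2 0 1 R) * yangianL1 q R b) =
      yangianL1 q R b * coeMat (leg2 0 1 R) * yangianL1 q R (a + 1) * coeMat (leg2 0 1 R) -
        yangianL1 q R (b + 1) * coeMat (leg2 0 1 R) * yangianL1 q R a * coeMat (leg2 0 1 R) -
        (q - q⁻¹) • (yangianL1 q R b * coeMat (leg2 0 1 R) * yangianL1 q R (a + 1)) := by
  have hφ : ∀ X : Matrix (Fin 2 → Fin N) (Fin 2 → Fin N) K,
      (RingQuot.mkAlgHom K (YangianRel q R)).mapMatrix (coeMat X) = coeMat X := fun X => by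
    ext i j
    exact AlgHom.commutes _ _
  have key : (RingQuot.mkAlgHom K (YangianRel q R)).mapMatrix (yangianLeft q R a b) =
      (RingQuot.mkAlgHom K (YangianRel q R)).mapMatrix (yangianRight q R a b) := by
    ext i j
    exact RingQuot.mkAlgHom_rel K (YangianRel.mk a b i j)
  simp only [yangianLeft, yangianRight, map_sub, map_smul, map_mul, hφ] at key
  exact key

variable {q R}

theorem isStringMatrix_genMatrix (hq : IsGeneric q) : IsStringMatrix q R (genMatrix q R) := by
  have hL : ∀ a n, (leg1 (0 : Fin 2) ((genMatrix q R).map (shift q a))).map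
      (PowerSeries.coeff n) = (q ^ (2 * a)) ^ n • yangianL1 q R n := fun a n => by
    ext i j
    simp only [yangianL1, freeL1, leg1, Matrix.map_apply, Matrix.smul_apply, Matrix.of_apply]
    split_ifs
    · rw [coeff_shift, genMatrix, Matrix.of_apply, PowerSeries.coeff_mk]
    · simp
  intro a m
  have hb : ∀ A [Ring A] [Algebra K A], baxter q m (coeMat (leg2 0 1 R) :
      Matrix (Fin 2 → Fin N) (Fin 2 → Fin N) A) = coeMat (baxter q m (leg2 0 1 R)) := by
    intro A _ _
    rw [← coeMatHom_apply, ← coeMatHom_apply, baxter, baxter, map_sub, map_smul, map_smul, map_one]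
  refine matrix_ext_coeff fun n => ?_
  have key := sum_baxter_relations hq (yangianL1_neg_one q R) (yangianL1_zero q R)
    (yangianL1_rel q R) (q ^ (2 * a)) m n
  have e : q ^ (2 * (a + m)) = q ^ (2 * a) * q ^ (2 * m) := by ring
  rw [map_coeff_mul, hb, mul_assoc _ (leg1 0 _) (coeMat (baxter _ _ _)), map_coeff_mul_reflect]
  simp only [map_coeff_coeMat_mul, map_coeff_mul_coeMat, hL]
  rw [hb] at key
  calc _ = _ := Finset.sum_congr rfl fun i _ => ?_
    _ = _ := key
    _ = _ := Finset.sum_congr rfl fun i _ => ?_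
  · simp only [smul_mul_assoc, mul_smul_comm, smul_smul, e]
    rw [mul_comm]
  · simp only [smul_mul_assoc, mul_smul_comm, smul_smul, e, mul_assoc]

end Yangian

section Identities

variable {K : Type*} [Field K] {N : ℕ} {A : Type*} [Ring A] [Algebra K A]
  {q : K} {R Ψ : Matrix (Fin N × Fin N) (Fin N × Fin N) K} {L : Matrix (Fin N) (Fin N) A⟦X⟧}

/-- The Cayley–Hamilton–Newton identities. -/
theorem IsStringMatrix.cayleyHamiltonNewton (hL : IsStringMatrix q R L) (hq : IsGeneric q)
    (hR : IsHeckeSymmetry q R) (hΨ : IsSkewInverse R Ψ) (k : ℕ) :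
    ((-1) ^ (k + 1) * qint q k) • lskew q R (matC Ψ) L k =
      ∑ p ∈ Finset.range k, (-q) ^ p • ((lpow q L (k - p)).map (shift q p) *
        Matrix.scalar (Fin N) (elem q R (matC Ψ) L p)) := by
  induction k with
  | zero => simp
  | succ n ih =>
    have e : ∀ p ∈ Finset.range n, (-q) ^ p • ((lpow q L (n + 1 - p)).map (shift q p) *
        Matrix.scalar (Fin N) (elem q R (matC Ψ) L p)) = L.map (shift q n) *
        ((-q) ^ p • ((lpow q L (n - p)).map (shift q p) *
          Matrix.scalar (Fin N) (elem q R (matC Ψ) L p))) := fun p hp => by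
      have := Finset.mem_range.mp hp
      rw [show n + 1 - p = (n - p) + 1 by omega, map_shift_lpow_succ,
        show n - p + p = n by omega, mul_smul_comm, mul_assoc]
    rw [Finset.sum_range_succ, Finset.sum_congr rfl e, ← Finset.mul_sum, ← ih, mul_smul,
      hL.lskew_succ hq hR hΨ, Nat.add_sub_cancel_left, map_shift_lpow_succ, map_shift_lpow_zero,
      zero_add, mul_one, ← mul_smul_comm, ← mul_smul_comm, ← mul_add, neg_pow q n]
    congr 1
    module

theorem sum_Icc_one_eq_sum_range {M : Type*} [AddCommMonoid M] (f : ℕ → ℕ → M) (k : ℕ) :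
    ∑ p ∈ Finset.Icc 1 k, f p (k - p) = ∑ p ∈ Finset.range k, f (k - p) p := by
  refine Finset.sum_nbij' (fun p => k - p) (fun p => k - p) ?_ ?_ ?_ ?_ ?_ <;>
    intro p hp <;> simp only [Finset.mem_Icc, Finset.mem_range] at hp ⊢
  any_goals omega
  rw [show k - (k - p) = p by omega]

theorem rTrace_sum (C : Matrix (Fin N) (Fin N) K) {ι : Type*} (s : Finset ι)
    (f : ι → Matrix (Fin N) (Fin N) A⟦X⟧) :
    rTrace C (∑ i ∈ s, f i) = ∑ i ∈ s, rTrace C (f i) := by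
  simp only [rTrace, Matrix.sum_apply, Finset.smul_sum]
  rw [Finset.sum_comm_cycle.symm]
  exact Finset.sum_comm_cycle.symm

theorem rTrace_smul (C : Matrix (Fin N) (Fin N) K) (c : K) (M : Matrix (Fin N) (Fin N) A⟦X⟧) :
    rTrace C (c • M) = c • rTrace C M := by
  simp only [rTrace, Matrix.smul_apply, Finset.smul_sum, smul_comm c]

theorem rTrace_mul_scalar (C : Matrix (Fin N) (Fin N) K) (M : Matrix (Fin N) (Fin N) A⟦X⟧)
    (e : A⟦X⟧) : rTrace C (M * Matrix.scalar (Fin N) e) = rTrace C M * e := by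
  simp [rTrace, Finset.sum_mul]

theorem rTrace_map_shift (C : Matrix (Fin N) (Fin N) K) (M : Matrix (Fin N) (Fin N) A⟦X⟧)
    (j : ℕ) : rTrace C (M.map (shift q j)) = shift q j (rTrace C M) := by
  change _ = shiftHom q A j _
  simp only [rTrace, map_sum, map_smul]
  rfl

/-- The quantum Newton identities. -/
theorem IsStringMatrix.newton (hL : IsStringMatrix q R L) (hq : IsGeneric q)
    (hR : IsHeckeSymmetry q R) (hΨ : IsSkewInverse R Ψ) (k : ℕ) (hk : 1 ≤ k) :
    ∑ p ∈ Finset.range k, (-q) ^ p • (shift q p (psum q (matC Ψ) L (k - p)) *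
      elem q R (matC Ψ) L p) + ((-1) ^ k * qint q k) • elem q R (matC Ψ) L k = 0 := by
  have h := congrArg (rTrace (matC Ψ)) (hL.cayleyHamiltonNewton hq hR hΨ k)
  simp only [rTrace_sum, rTrace_smul, rTrace_mul_scalar, rTrace_map_shift] at h
  obtain ⟨k, rfl⟩ : ∃ j, k = j + 1 := ⟨k - 1, by omega⟩
  simp only [psum]
  rw [← h, elem, ← add_smul]
  rw [pow_succ _ (k + 1)]
  simp

/-- A matrix series with leading coefficient `I` is not a left divisor of zero. -/
theorem eq_zero_of_mul_eq_zero {M Y : Matrix (Fin N) (Fin N) A⟦X⟧}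
    (hM : M.map (PowerSeries.coeff 0) = 1) (h : M * Y = 0) : Y = 0 := by
  refine matrix_ext_coeff fun n => ?_
  induction n using Nat.strong_induction_on with
  | _ n ih =>
    have h1 := congrArg (fun Z : Matrix (Fin N) (Fin N) A⟦X⟧ => Z.map (PowerSeries.coeff n)) h
    simp only [map_coeff_mul] at h1
    rw [Finset.sum_range_succ'] at h1
    rw [Finset.sum_eq_zero, zero_add, hM, one_mul, Nat.sub_zero] at h1
    · exact h1
    · intro k hk
      have := Finset.mem_range.mp hk
      rw [ih (n - (k + 1)) (by omega)]
      ext i j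
      simp [Matrix.mul_apply]

/-- The Cayley–Hamilton identity, when the skew-symmetrizer of order `m + 1` vanishes. -/
theorem IsStringMatrix.cayleyHamilton (hL : IsStringMatrix q R L) (hq : IsGeneric q)
    (hR : IsHeckeSymmetry q R) (hΨ : IsSkewInverse R Ψ) (hL0 : L.map (PowerSeries.coeff 0) = 1)
    (m : ℕ) (hm : skewSymmetrizer q R (m + 1) = 0) :
    ∑ p ∈ Finset.range (m + 1), (-q) ^ p • ((lpow q L (m - p)).map (shift q p) *
      Matrix.scalar (Fin N) (elem q R (matC Ψ) L p)) = 0 := by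
  have h0 : lskew q R (matC Ψ) L (m + 1) = 0 := by
    have : ∀ k, rTraceTail (matC Ψ) k
        (0 : Matrix (Fin (k + 1) → Fin N) (Fin (k + 1) → Fin N) A⟦X⟧) = 0 := fun k =>
      map_zero (rTraceTailHom (matC Ψ) k)
    rw [lskew, hm, ← coeMatHom_apply, map_zero, zero_mul, this]
  have h := hL.cayleyHamiltonNewton hq hR hΨ (m + 1)
  rw [h0, smul_zero] at h
  refine eq_zero_of_mul_eq_zero (M := L.map (shift q m)) ?_ ?_
  · rw [← hL0]
    ext i j
    simp only [Matrix.map_apply, coeff_shift, pow_zero, one_smul]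
  · rw [h, Finset.mul_sum]
    refine Finset.sum_congr rfl fun p hp => ?_
    have := Finset.mem_range.mp hp
    rw [show m + 1 - p = (m - p) + 1 by omega, map_shift_lpow_succ,
      show m - p + p = m by omega, mul_smul_comm, mul_assoc]

end Identities

section BiRank

variable {K : Type*} [Field K] {N : ℕ} {q : K} {R : Matrix (Fin N × Fin N) (Fin N × Fin N) K}

theorem HasBiRank.finrank_eq_zero {m : ℕ} (h : HasBiRank q R m 0) :
    Module.finrank K (((Fin (m + 1) → Fin N) → K) ⧸ exteriorRelations q R (m + 1)) = 0 := by
  obtain ⟨f, g, hfg, hf, hg, h⟩ := h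
  rw [Polynomial.natDegree_eq_zero] at hg
  obtain ⟨c, rfl⟩ := hg
  have hc : c ≠ 0 := by
    rintro rfl
    simp only [map_zero, Polynomial.coe_zero, zero_mul] at h
    have hf0 : f = 0 := Polynomial.coe_injective ℚ (by simpa using h.symm)
    rw [hf0, map_zero] at hfg
    exact not_isCoprime_zero_zero hfg
  have h1 := congrArg (PowerSeries.coeff (m + 1)) h
  rw [Polynomial.coe_C, PowerSeries.coeff_C_mul, Polynomial.coeff_coe,
    Polynomial.coeff_eq_zero_of_natDegree_lt (by omega), poincareSeries, PowerSeries.coeff_mk] at h1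
  exact_mod_cast (mul_eq_zero.mp h1).resolve_left hc

theorem IsHeckeSymmetry.skewSymmetrizer_eq_zero (hR : IsHeckeSymmetry q R) (hq : IsGeneric q)
    {n : ℕ} (h : exteriorRelations q R n = ⊤) : skewSymmetrizer q R n = 0 := by
  have hle : exteriorRelations q R n ≤ LinearMap.ker (Matrix.vecMulLinear (skewSymmetrizer q R n)) := by
    refine iSup_le fun s => iSup_le fun t => iSup_le fun hst => ?_
    rintro _ ⟨v, rfl⟩
    rw [LinearMap.mem_ker, Matrix.vecMulLinear_apply, Matrix.vecMulLinear_apply, Matrix.vecMul_vecMul]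
    have h1 := ((hR.heckeRelations hq.1 n).antisym_absorb hq n s (by omega)).1
    rw [gen_of_lt (by omega)] at h1
    rw [show (⟨s + 1, by omega⟩ : Fin n) = t from Fin.ext hst.symm] at h1
    rw [skewSymmetrizer_eq_antisym, add_comm, h1, Matrix.vecMul_zero]
  rw [h] at hle
  ext a b
  have := hle (Submodule.mem_top (x := Pi.single a 1))
  rw [LinearMap.mem_ker, Matrix.vecMulLinear_apply, Matrix.single_one_vecMul] at this
  exact congrFun this b

theorem HasBiRank.skewSymmetrizer_eq_zero {m : ℕ} (h : HasBiRank q R m 0)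
    (hR : IsHeckeSymmetry q R) (hq : IsGeneric q) : skewSymmetrizer q R (m + 1) = 0 := by
  refine hR.skewSymmetrizer_eq_zero hq ?_
  have := h.finrank_eq_zero
  rw [Module.finrank_zero_iff, Submodule.Quotient.subsingleton_iff] at this
  exact this

theorem map_coeff_zero_genMatrix : (genMatrix q R).map (PowerSeries.coeff 0) = 1 := by
  ext i j
  have h : freeL K N (0 : ℕ) = 1 := rfl
  rw [Matrix.map_apply, genMatrix, Matrix.of_apply, PowerSeries.coeff_mk, h, Matrix.one_apply,
    Matrix.one_apply, apply_ite (RingQuot.mkAlgHom K (YangianRel q R)), map_one, map_zero]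

end BiRank

end BraidedYangian

open BraidedYangian

theorem proposition6 {K : Type*} [Field K] {N : ℕ} (q : K) (hq : IsGeneric q)
    (R Ψ : Matrix (Fin N × Fin N) (Fin N × Fin N) K)
    (hR : IsHeckeSymmetry q R) (hΨ : IsSkewInverse R Ψ) :
    -- the Cayley–Hamilton–Newton identities
    (∀ k : ℕ, 1 ≤ k →
      ((-1) ^ (k + 1) * qint q k) • lskew q R (matC Ψ) (genMatrix q R) k =
        ∑ p ∈ Finset.Icc 1 k, (-q) ^ (k - p) •
          ((lpow q (genMatrix q R) p).map (shift q (k - p)) *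
            Matrix.scalar (Fin N) (elem q R (matC Ψ) (genMatrix q R) (k - p)))) ∧
    -- the Cayley–Hamilton identity for the bi-rank `(m|0)`
    (∀ m : ℕ, HasBiRank q R m 0 →
      ∑ p ∈ Finset.range (m + 1), (-q) ^ p •
        ((lpow q (genMatrix q R) (m - p)).map (shift q p) *
          Matrix.scalar (Fin N) (elem q R (matC Ψ) (genMatrix q R) p)) = 0) ∧
    -- the quantum Newton identities
    (∀ k : ℕ, 1 ≤ k →
      ∑ p ∈ Finset.range k, (-q) ^ p •
        (shift q p (psum q (matC Ψ) (genMatrix q R) (k - p)) *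
          elem q R (matC Ψ) (genMatrix q R) p) +
        ((-1) ^ k * qint q k) • elem q R (matC Ψ) (genMatrix q R) k = 0) := by
  have hL : IsStringMatrix q R (genMatrix q R) := isStringMatrix_genMatrix hq
  refine ⟨fun k _ => ?_, fun m hm => ?_, fun k hk => hL.newton hq hR hΨ k hk⟩
  · rw [hL.cayleyHamiltonNewton hq hR hΨ k]
    exact (sum_Icc_one_eq_sum_range (fun p j => (-q) ^ j •
      ((lpow q (genMatrix q R) p).map (shift q j) *
        Matrix.scalar (Fin N) (elem q R (matC Ψ) (genMatrix q R) j))) k).symm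
  · exact hL.cayleyHamilton hq hR hΨ map_coeff_zero_genMatrix m (hm.skewSymmetrizer_eq_zero hR hq)
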